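/- Let $R$ be an associative ring with identity and with an involution $a\mapsto\bar a$, let $\lambda\in R$ be central with $\lambda\bar\lambda=1$, and let $\Lambda$ be a $\lambda$-form parameter: an additive subgroup of $R$ with $\{a-\lambda\bar a: a\in R\}\subseteq\Lambda\subseteq\{a\in R: a=-\lambda\bar a\}$ and $\bar x\Lambda x\subseteq\Lambda$ for all $x\in R$. For a matrix $M=(m_{ij})$ put $M^*=(\overline{m_{ji}})$, and put $\bar\Lambda=\{\bar a: a\in\Lambda\}$. A square matrix $\gamma$ is $\Lambda$-Hermitian if $\gamma=-\lambda\gamma^*$ and its diagonal entries lie in $\Lambda$; $\beta$ is $\bar\Lambda$-Hermitian if $\beta=-\bar\lambda\beta^*$ and its diagonal entries lie in $\bar\Lambda$. Let $\mathrm{GQ}^\lambda(2n,R,\Lambda)$ be the group of all $\sigma=\begin{pmatrix}a&b\\c&d\end{pmatrix}\in \mathrm{GL}_{2n}(R)$, with $n\times n$ blocks, such that $\sigma^*\psi_n\sigma=\psi_n$ for $\psi_n=\begin{pmatrix}0&\mathrm I_n\\ \lambda \mathrm I_n&0\end{pmatrix}$ and the diagonal entries of $a^*c$ and $b^*d$ lie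 in $\Lambda$. Let $\mathrm{EQ}^\lambda(2n,R,\Lambda)$ be the subgroup generated by the matrices $\begin{pmatrix}\varepsilon&0\\0&(\varepsilon^*)^{-1}\end{pmatrix}$ with $\varepsilon$ in the elementary group $\mathrm E_n(R)$, $\begin{pmatrix}\mathrm I_n&\beta\\0&\mathrm I_n\end{pmatrix}$ with $\beta$ $\bar\Lambda$-Hermitian, and $\begin{pmatrix}\mathrm I_n&0\\\gamma&\mathrm I_n\end{pmatrix}$ with $\gamma$ $\Lambda$-Hermitian. Let $\mathrm{GQ}^\lambda(R,\Lambda)$ and $\mathrm{EQ}^\lambda(R,\Lambda)$ be the direct limits over $n$ along the stabilization maps $$\begin{pmatrix}a&b\\c&d\end{pmatrix}\mapsto\begin{pmatrix}a&0&b&0\\0&1&0&0\\c&0&d&0\\0&0&0&1\end{pmatrix},$$ and let $\mathrm{K_1GQ}^\lambda(R,\Lambda)=\mathrm{GQ}^\lambda(R,\Lambda)/\mathrm{EQ}^\lambda(R,\Lambda)$, in which $[\alpha]$ denotes the class of $\alpha$. Extend the involution to $R[X]$ by $\bar X=X$, let $\Lambda[X]$ be the set of polynomials with all coefficients in $\Lambda$,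 and let $\mathrm{NK_1GQ}^\lambda(R,\Lambda)$ be the kernel of the homomorphism $\mathrm{K_1GQ}^\lambda(R[X],\Lambda[X])\to\mathrm{K_1GQ}^\lambda(R,\Lambda)$ induced by $X\mapsto0$. Theorem. Let $k,r\in\mathbb N$, and let $\alpha(X)=\begin{pmatrix}A(X)&B(X)\\C(X)&D(X)\end{pmatrix}\in\mathrm{GQ}^\lambda(2r,R[X],\Lambda[X])$ be such that $[\alpha(X)]\in\mathrm{NK_1GQ}^\lambda(R,\Lambda)$ and $A(X)\in\mathrm{GL}_r(R[X])$. If $kR=R$, then $[\alpha(X)]$ has no $k$-torsion: if $[\alpha(X)]^k=1$ in $\mathrm{K_1GQ}^\lambda(R[X],\Lambda[X])$, then $[\alpha(X)]=1$. -/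

import Mathlib

open Matrix Polynomial

/-! ## The involution on polynomials -/

/-- The involution of `R` extended to `R[X]` by fixing `X`: it acts on the coefficients. -/
noncomputable instance polynomialStarRing {R : Type*} [Ring R] [StarRing R] : StarRing R[X] where
  star p := ⟨AddMonoidAlgebra.ofCoeff (p.toFinsupp.coeff.mapRange star (star_zero R))⟩
  star_involutive p := by
    ext n
    exact star_star (p.coeff n)
  star_mul p q := by
    ext n
    change star ((p * q).coeff n) = _
    rw [coeff_mul, coeff_mul, star_sum, ← Finset.Nat.sum_antidiagonal_swap]
    exact Finset.sum_congr rfl fun x _ => star_mul _ _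
  star_add p q := by
    ext n
    change star ((p + q).coeff n) = _
    rw [coeff_add, coeff_add, star_add]
    rfl

theorem coeff_star_poly {R : Type*} [Ring R] [StarRing R] (p : R[X]) (n : ℕ) :
    (star p).coeff n = star (p.coeff n) := rfl

/-! ## Form rings -/

/-- A form ring `(R, λ, Λ)`: a central element `λ` with `λ * star λ = 1` and a `λ`-form parameter
`Λ` on the ring with involution `R`. -/
structure FormRing (R : Type*) [Ring R] [StarRing R] where
  lam : R
  lam_central : ∀ x : R, lam * x = x * lam
  lam_mul_star : lam * star lam = 1
  param : AddSubgroup R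
  min_le : ∀ a : R, a - lam * star a ∈ param
  le_max : ∀ a ∈ param, a = -(lam * star a)
  conj_mem : ∀ x : R, ∀ a ∈ param, star x * a * x ∈ param

namespace FormRing

section Basic

variable {R : Type*} [Ring R] [StarRing R] (F : FormRing R)

theorem star_mul_lam : star F.lam * F.lam = 1 := by
  rw [← F.lam_central, F.lam_mul_star]

theorem star_lam_central (x : R) : star F.lam * x = x * star F.lam := by
  have h := congrArg star (F.lam_central (star x))
  simpa using h.symm

/-- The form ring `(R, star λ, star Λ)`. -/
def bar : FormRing R where
  lam := star F.lam
  lam_central := F.star_lam_central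
  lam_mul_star := by rw [star_star, F.star_mul_lam]
  param :=
    { carrier := {a | star a ∈ F.param}
      add_mem' := fun {a b} ha hb => by
        simpa using F.param.add_mem ha hb
      zero_mem' := by simp
      neg_mem' := fun {a} ha => by simpa using ha }
  min_le := fun a => by
    have h := F.min_le (star a)
    simpa [F.lam_central] using h
  le_max := fun a ha => by
    have h := congrArg star (F.le_max _ ha)
    simpa [F.star_lam_central] using h
  conj_mem := fun x a ha => by
    have h := F.conj_mem x _ ha
    change star (star x * a * x) ∈ F.param
    simpa [mul_assoc] using h

/-- The form ring `(R[X], λ, Λ[X])`; `Λ[X]` consists of the polynomials with coefficients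
in `Λ`. -/
noncomputable def poly : FormRing R[X] where
  lam := C F.lam
  lam_central := fun p => by
    ext n
    simp [F.lam_central]
  lam_mul_star := by
    ext n
    have h : star (C F.lam) = C (star F.lam) := by
      ext m
      rw [coeff_star_poly, coeff_C, coeff_C]
      split_ifs <;> simp
    rw [h, ← C_mul, F.lam_mul_star, C_1]
  param :=
    { carrier := {p | ∀ n, p.coeff n ∈ F.param}
      add_mem' := fun {a b} ha hb n => by
        rw [coeff_add]
        exact F.param.add_mem (ha n) (hb n)
      zero_mem' := fun n => by simp
      neg_mem' := fun {a} ha n => by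
        rw [coeff_neg]
        exact F.param.neg_mem (ha n) }
  min_le := fun p n => by
    rw [coeff_sub, coeff_C_mul, coeff_star_poly]
    exact F.min_le _
  le_max := fun p hp => by
    ext n
    rw [coeff_neg, coeff_C_mul, coeff_star_poly]
    exact F.le_max _ (hp n)
  conj_mem := fun x => by
    intro a ha
    have ha' : a = -(C F.lam * star a) := by
      ext n
      rw [coeff_neg, coeff_C_mul, coeff_star_poly]
      exact F.le_max _ (ha n)
    have hC : ∀ p : R[X], C F.lam * p = p * C F.lam := fun p => by
      ext n
      simp [F.lam_central]
    induction x using Polynomial.induction_on' with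
    | add p q hp hq =>
      intro n
      have h1 : star (p + q) * a * (p + q) =
          star p * a * p + star q * a * q +
            (star p * a * q - C F.lam * star (star p * a * q)) := by
        have h2 : C F.lam * star (star p * a * q) = -(star q * a * p) := by
          conv_rhs => rw [ha']
          simp only [star_mul, star_star, mul_neg, neg_mul, neg_neg]
          rw [hC (star q * (star a * p)), hC (star a)]
          simp only [mul_assoc]
          rw [hC p]
        rw [h2, star_add]
        noncomm_ring
      rw [h1, coeff_add, coeff_add, coeff_sub, coeff_C_mul, coeff_star_poly]
      exact F.param.add_mem (F.param.add_mem (hp n) (hq n)) (F.min_le _)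
    | monomial m c =>
      intro n
      have h1 : star (monomial m c) = monomial m (star c) := by
        ext i
        rw [coeff_star_poly, coeff_monomial, coeff_monomial]
        split_ifs <;> simp
      rw [h1, ← C_mul_X_pow_eq_monomial, ← C_mul_X_pow_eq_monomial, ← mul_assoc,
        coeff_mul_X_pow', mul_assoc (C (star c)), X_pow_mul, ← mul_assoc,
        mul_assoc _ (X ^ m) (C c), X_pow_mul, ← mul_assoc, coeff_mul_X_pow', coeff_mul_C,
        coeff_C_mul]
      split_ifs
      · exact F.conj_mem _ _ (ha _)
      · exact F.param.zero_mem
      · exact F.param.zero_mem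

/-! ## Hermitian matrices -/

/-- `Λ`-Hermitian matrices: `M = -λ M*` and the diagonal entries lie in `Λ`. -/
def IsHerm {n : Type*} (M : Matrix n n R) : Prop :=
  M = -(F.lam • Mᴴ) ∧ ∀ i, M i i ∈ F.param

variable {F}

theorem IsHerm.add {n : Type*} {M N : Matrix n n R} (hM : F.IsHerm M) (hN : F.IsHerm N) :
    F.IsHerm (M + N) := by
  refine ⟨?_, fun i => F.param.add_mem (hM.2 i) (hN.2 i)⟩
  conv_lhs => rw [hM.1, hN.1]
  rw [conjTranspose_add, smul_add, neg_add]

theorem IsHerm.neg {n : Type*} {M : Matrix n n R} (hM : F.IsHerm M) : F.IsHerm (-M) := by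
  refine ⟨?_, fun i => F.param.neg_mem (hM.2 i)⟩
  conv_lhs => rw [hM.1]
  rw [conjTranspose_neg, smul_neg]

theorem isHerm_zero {n : Type*} : F.IsHerm (0 : Matrix n n R) := by
  refine ⟨by simp, fun i => F.param.zero_mem⟩

variable (F) in
theorem mul_lam_smul {l m n : Type*} [Fintype m] (M : Matrix l m R) (N : Matrix m n R) :
    M * (F.lam • N) = F.lam • (M * N) := by
  ext i j
  simp only [mul_apply, Matrix.smul_apply, smul_eq_mul, Finset.mul_sum]
  refine Finset.sum_congr rfl fun x _ => ?_
  rw [← mul_assoc, ← mul_assoc, F.lam_central]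

variable (F) in
theorem conjTranspose_lam_smul {m n : Type*} (M : Matrix m n R) :
    (F.lam • M)ᴴ = star F.lam • Mᴴ := by
  ext i j
  simp [F.star_lam_central]

theorem IsHerm.conj {m n : Type*} [Fintype n] {M : Matrix n n R}
    (hM : F.IsHerm M) (N : Matrix n m R) : F.IsHerm (Nᴴ * M * N) := by
  classical
  refine ⟨?_, fun i => ?_⟩
  · conv_lhs => rw [hM.1]
    simp only [conjTranspose_mul, conjTranspose_conjTranspose, Matrix.mul_neg, Matrix.neg_mul]
    rw [F.mul_lam_smul, Matrix.smul_mul, Matrix.mul_assoc]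
  · have h0 : (Nᴴ * M * N) i i = ∑ p : n × n, star (N p.1 i) * M p.1 p.2 * N p.2 i := by
      rw [Fintype.sum_prod_type_right, mul_apply]
      refine Finset.sum_congr rfl fun y _ => ?_
      rw [mul_apply, Finset.sum_mul]
      rfl
    have hsymm : ∀ x y, M y x = -(F.lam * star (M x y)) := fun x y => by
      conv_lhs => rw [hM.1]
      rfl
    rw [h0, ← QuotientAddGroup.eq_zero_iff, QuotientAddGroup.mk_sum]
    refine Finset.sum_involution (fun p _ => p.swap) ?_ ?_ (fun _ _ => Finset.mem_univ _)
      (fun _ _ => rfl)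
    · rintro ⟨x, y⟩ -
      rw [← QuotientAddGroup.mk_add, QuotientAddGroup.eq_zero_iff]
      have h := F.min_le (star (N x i) * M x y * N y i)
      convert h using 1
      simp only [Prod.swap, hsymm x y, star_mul, star_star, sub_eq_add_neg]
      congr 1
      simp only [mul_neg, neg_mul, ← mul_assoc]
      rw [F.lam_central]
    · rintro ⟨x, y⟩ - hne heq
      apply hne
      obtain rfl : y = x := congrArg Prod.fst heq
      rw [QuotientAddGroup.eq_zero_iff]
      exact F.conj_mem _ _ (hM.2 _)

end Basic

/-! ## The groups `GQ` and `EQ` -/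

section Groups

variable {R : Type*} [Ring R] [StarRing R] (F : FormRing R)
variable (ι : Type*) [Fintype ι] [DecidableEq ι]

/-- The matrix `ψ = (0 I; λI 0)`. -/
def psi : Matrix (ι ⊕ ι) (ι ⊕ ι) R := fromBlocks 0 1 (F.lam • 1) 0

/-- The matrix `(0 I; 0 0)`. -/
def phi (R : Type*) [Ring R] (ι : Type*) [DecidableEq ι] : Matrix (ι ⊕ ι) (ι ⊕ ι) R :=
  fromBlocks 0 1 0 0

variable {ι}

/-- A matrix `(a b; c d)` is `Λ`-quadratic if it preserves `ψ` and the diagonal entries of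
`a* c` and `b* d` lie in `Λ`. -/
def IsQuadratic (σ : Matrix (ι ⊕ ι) (ι ⊕ ι) R) : Prop :=
  σᴴ * F.psi ι * σ = F.psi ι ∧
    (∀ i, (σ.toBlocks₁₁ᴴ * σ.toBlocks₂₁) i i ∈ F.param) ∧
    (∀ i, (σ.toBlocks₁₂ᴴ * σ.toBlocks₂₂) i i ∈ F.param)

theorem isQuadratic_iff (σ : Matrix (ι ⊕ ι) (ι ⊕ ι) R) :
    F.IsQuadratic σ ↔ F.IsHerm (σᴴ * phi R ι * σ - phi R ι) := by
  have hpsi : F.psi ι = phi R ι + F.lam • (phi R ι)ᴴ := by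
    simp [psi, phi, fromBlocks_conjTranspose, fromBlocks_smul, fromBlocks_add]
  have h1 : σᴴ * F.psi ι * σ - F.psi ι = (σᴴ * phi R ι * σ - phi R ι) +
      F.lam • (σᴴ * phi R ι * σ - phi R ι)ᴴ := by
    simp only [hpsi, conjTranspose_sub, conjTranspose_mul, conjTranspose_conjTranspose,
      Matrix.mul_add, Matrix.add_mul, F.mul_lam_smul, Matrix.smul_mul, smul_sub, Matrix.mul_assoc]
    abel
  have h2 : ∀ i, (σᴴ * phi R ι * σ - phi R ι) i i =
      Sum.elim (fun i => (σ.toBlocks₁₁ᴴ * σ.toBlocks₂₁) i i)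
        (fun i => (σ.toBlocks₁₂ᴴ * σ.toBlocks₂₂) i i) i := by
    intro i
    conv_lhs => rw [← fromBlocks_toBlocks σ]
    rw [phi, fromBlocks_conjTranspose, fromBlocks_multiply, fromBlocks_multiply]
    cases i <;> simp
  unfold IsQuadratic IsHerm
  rw [← sub_eq_zero, h1, ← eq_neg_iff_add_eq_zero]
  refine and_congr Iff.rfl ?_
  simp only [h2]
  constructor
  · rintro ⟨ha, hb⟩ (i | i)
    · exact ha i
    · exact hb i
  · exact fun h => ⟨fun i => h (Sum.inl i), fun i => h (Sum.inr i)⟩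

variable (ι)

/-- The `Λ`-quadratic group `GQ(2n, R, Λ)`, with `n` the size of `ι`. -/
def GQ : Subgroup (Matrix (ι ⊕ ι) (ι ⊕ ι) R)ˣ where
  carrier := {σ | F.IsQuadratic (σ : Matrix (ι ⊕ ι) (ι ⊕ ι) R)}
  one_mem' := by
    change F.IsQuadratic _
    rw [isQuadratic_iff]
    simpa using isHerm_zero
  mul_mem' := fun {σ τ} hσ hτ => by
    change F.IsQuadratic _ at hσ hτ ⊢
    rw [isQuadratic_iff] at hσ hτ ⊢
    convert (hσ.conj (τ : Matrix (ι ⊕ ι) (ι ⊕ ι) R)).add hτ using 1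
    rw [Units.val_mul, conjTranspose_mul]
    noncomm_ring
  inv_mem' := fun {σ} hσ => by
    change F.IsQuadratic _ at hσ ⊢
    rw [isQuadratic_iff] at hσ ⊢
    convert (hσ.conj ((σ⁻¹ : (Matrix (ι ⊕ ι) (ι ⊕ ι) R)ˣ) : Matrix (ι ⊕ ι) (ι ⊕ ι) R)).neg using 1
    have h1 : (σ : Matrix (ι ⊕ ι) (ι ⊕ ι) R) * ((σ⁻¹ : (Matrix (ι ⊕ ι) (ι ⊕ ι) R)ˣ) :
      Matrix (ι ⊕ ι) (ι ⊕ ι) R) = 1 := σ.mul_inv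
    have h2 := congrArg conjTranspose h1
    rw [conjTranspose_mul, conjTranspose_one] at h2
    generalize ((σ⁻¹ : (Matrix (ι ⊕ ι) (ι ⊕ ι) R)ˣ) : Matrix (ι ⊕ ι) (ι ⊕ ι) R) = τ at h1 h2 ⊢
    generalize (σ : Matrix (ι ⊕ ι) (ι ⊕ ι) R) = s at h1 h2 ⊢
    rw [Matrix.mul_sub, Matrix.sub_mul, neg_sub]
    congr 1
    rw [show τᴴ * (sᴴ * phi R ι * s) * τ = (τᴴ * sᴴ) * phi R ι * (s * τ) by
      simp only [Matrix.mul_assoc], h1, h2]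
    simp

variable {F ι} in
theorem mem_GQ_iff {σ : (Matrix (ι ⊕ ι) (ι ⊕ ι) R)ˣ} :
    σ ∈ F.GQ ι ↔ F.IsHerm ((σ : Matrix (ι ⊕ ι) (ι ⊕ ι) R)ᴴ * phi R ι *
      (σ : Matrix (ι ⊕ ι) (ι ⊕ ι) R) - phi R ι) :=
  F.isQuadratic_iff _

/-- The elementary group `E_n(R)`, generated by the matrices `I + a e_ij` with `i ≠ j`. -/
def elementaryGroup (R : Type*) [Ring R] (ι : Type*) [Fintype ι] [DecidableEq ι] :
    Subgroup (Matrix ι ι R)ˣ :=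
  Subgroup.closure {u | ∃ (i j : ι) (a : R), i ≠ j ∧ (u : Matrix ι ι R) = 1 + single i j a}

variable {ι}

/-- The hyperbolic matrix `H(u) = (u 0; 0 (u*)⁻¹)`. -/
def hyp (u : (Matrix ι ι R)ˣ) : F.GQ ι where
  val :=
    { val := fromBlocks (u : Matrix ι ι R) 0 0 ((u⁻¹ : (Matrix ι ι R)ˣ) : Matrix ι ι R)ᴴ
      inv := fromBlocks ((u⁻¹ : (Matrix ι ι R)ˣ) : Matrix ι ι R) 0 0 (u : Matrix ι ι R)ᴴ
      val_inv := by
        rw [fromBlocks_multiply]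
        simp [← conjTranspose_mul]
      inv_val := by
        rw [fromBlocks_multiply]
        simp [← conjTranspose_mul] }
  property := by
    rw [mem_GQ_iff]
    simp only [phi, fromBlocks_conjTranspose, fromBlocks_multiply]
    simp [← conjTranspose_mul]
    exact isHerm_zero

/-- `T₁₂(β) = (I β; 0 I)` for a `star Λ`-Hermitian matrix `β`. -/
def upper (β : Matrix ι ι R) (hβ : F.bar.IsHerm β) : F.GQ ι where
  val :=
    { val := fromBlocks 1 β 0 1
      inv := fromBlocks 1 (-β) 0 1
      val_inv := by simp [fromBlocks_multiply]
      inv_val := by simp [fromBlocks_multiply] }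
  property := by
    rw [mem_GQ_iff]
    have h : βᴴ = -(F.lam • β) := by
      conv_lhs => rw [hβ.1]
      ext i j
      simp [bar, F.lam_central]
    simp only [phi, fromBlocks_conjTranspose, fromBlocks_multiply, sub_eq_add_neg, fromBlocks_neg,
      fromBlocks_add]
    refine ⟨?_, ?_⟩
    · have h2 : -(F.lam • (-(F.lam • β))ᴴ) = -(F.lam • β) := by
        rw [← h, conjTranspose_conjTranspose, h]
      simp only [conjTranspose_one, conjTranspose_zero, Matrix.mul_one, Matrix.zero_mul,
        Matrix.mul_zero, add_zero, zero_add, h, fromBlocks_conjTranspose,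
        fromBlocks_smul, fromBlocks_neg, smul_zero, neg_zero, add_neg_cancel, h2]
    · rintro (i | i)
      · simp
      · have h3 : star (β i i) ∈ F.param := hβ.2 i
        simpa using h3

/-- `T₂₁(γ) = (I 0; γ I)` for a `Λ`-Hermitian matrix `γ`. -/
def lower (γ : Matrix ι ι R) (hγ : F.IsHerm γ) : F.GQ ι where
  val :=
    { val := fromBlocks 1 0 γ 1
      inv := fromBlocks 1 0 (-γ) 1
      val_inv := by simp [fromBlocks_multiply]
      inv_val := by simp [fromBlocks_multiply] }
  property := by
    rw [mem_GQ_iff]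
    simp only [phi, fromBlocks_conjTranspose, fromBlocks_multiply, sub_eq_add_neg, fromBlocks_neg,
      fromBlocks_add]
    refine ⟨?_, ?_⟩
    · simpa [fromBlocks_conjTranspose, fromBlocks_smul, fromBlocks_neg] using hγ.1
    · rintro (i | i)
      · simpa using hγ.2 i
      · simp

variable (ι)

/-- The `Λ`-elementary quadratic group `EQ(2n, R, Λ)`, generated by `H(ε)` with `ε ∈ E_n(R)`, and
by `T₁₂(β)` and `T₂₁(γ)` with `β` `star Λ`-Hermitian and `γ` `Λ`-Hermitian. -/
def EQ : Subgroup (F.GQ ι) :=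
  Subgroup.closure
    ({g | ∃ ε ∈ elementaryGroup R ι, g = F.hyp ε} ∪
      {g | ∃ (β : Matrix ι ι R) (hβ : F.bar.IsHerm β), g = F.upper β hβ} ∪
      {g | ∃ (γ : Matrix ι ι R) (hγ : F.IsHerm γ), g = F.lower γ hγ})

end Groups

/-! ## Stabilization -/

set_option linter.unusedSectionVars false

section Stabilization

variable {R : Type*} [Ring R] [StarRing R] (F : FormRing R)
variable {ι κ μ : Type*} [Fintype ι] [DecidableEq ι] [Fintype κ] [DecidableEq κ]
  [Fintype μ] [DecidableEq μ]

/-- The `0`-`1` matrix of an injection `e` of index sets. -/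
def inclMatrix (R : Type*) [Ring R] (e : ι ↪ κ) : Matrix κ ι R :=
  Matrix.of fun k i => if k = e i then 1 else 0

theorem conjTranspose_inclMatrix_mul (e : ι ↪ κ) :
    (inclMatrix R e)ᴴ * inclMatrix R e = 1 := by
  ext i j
  rw [mul_apply]
  simp only [inclMatrix, conjTranspose_apply, of_apply]
  by_cases h : i = j
  · subst h
    simp
  · simp [one_apply_ne h, Ne.symm h]

theorem inclMatrix_trans (e : ι ↪ κ) (f : κ ↪ μ) :
    inclMatrix R (e.trans f) = inclMatrix R f * inclMatrix R e := by
  ext i j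
  rw [mul_apply]
  simp [inclMatrix]

/-- The embedding of `M` into the larger matrix ring which is `M` on the image of `e` and the
identity outside, written as `I + P (M - I) P*` with the `0`-`1` matrix `P` of `e`. -/
def matExt (e : ι ↪ κ) : Matrix ι ι R →* Matrix κ κ R where
  toFun M := 1 + inclMatrix R e * (M - 1) * (inclMatrix R e)ᴴ
  map_one' := by simp
  map_mul' M N := by
    have h : inclMatrix R e * (M - 1) * (inclMatrix R e)ᴴ *
        (inclMatrix R e * (N - 1) * (inclMatrix R e)ᴴ) =
        inclMatrix R e * ((M - 1) * (N - 1)) * (inclMatrix R e)ᴴ := by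
      calc _ = inclMatrix R e * (M - 1) * ((inclMatrix R e)ᴴ * inclMatrix R e) * (N - 1) *
            (inclMatrix R e)ᴴ := by simp only [Matrix.mul_assoc]
        _ = _ := by
          rw [conjTranspose_inclMatrix_mul, Matrix.mul_one]
          simp only [Matrix.mul_assoc]
    rw [Matrix.add_mul, Matrix.mul_add, Matrix.mul_add, h]
    have h2 : M * N - 1 = (M - 1) + (N - 1) + (M - 1) * (N - 1) := by noncomm_ring
    rw [h2]
    simp only [Matrix.mul_add, Matrix.add_mul, Matrix.one_mul, Matrix.mul_one]
    abel

theorem matExt_apply (e : ι ↪ κ) (M : Matrix ι ι R) :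
    matExt e M = 1 + inclMatrix R e * (M - 1) * (inclMatrix R e)ᴴ := rfl

/-- The injection `ι ⊕ ι ↪ κ ⊕ κ` acting as `e` on both halves. -/
def sumEmb (e : ι ↪ κ) : ι ⊕ ι ↪ κ ⊕ κ := e.sumMap e

theorem inclMatrix_sumEmb (e : ι ↪ κ) :
    inclMatrix R (sumEmb e) = fromBlocks (inclMatrix R e) 0 0 (inclMatrix R e) := by
  ext (i | i) (j | j) <;> simp [inclMatrix, sumEmb]

theorem matExt_fromBlocks (e : ι ↪ κ) (a b c d : Matrix ι ι R) :
    matExt (sumEmb e) (fromBlocks a b c d) =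
      fromBlocks (matExt e a) (inclMatrix R e * b * (inclMatrix R e)ᴴ)
        (inclMatrix R e * c * (inclMatrix R e)ᴴ) (matExt e d) := by
  rw [matExt_apply, inclMatrix_sumEmb, ← fromBlocks_one, ← fromBlocks_one, sub_eq_add_neg,
    fromBlocks_neg, fromBlocks_add, fromBlocks_conjTranspose, fromBlocks_multiply,
    fromBlocks_multiply, fromBlocks_add]
  simp [matExt_apply, sub_eq_add_neg]

theorem conjTranspose_matExt (e : ι ↪ κ) (M : Matrix ι ι R) :
    (matExt e M)ᴴ = matExt e Mᴴ := by
  simp [matExt_apply, Matrix.mul_assoc]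

theorem matExt_refl (M : Matrix ι ι R) : matExt (Function.Embedding.refl ι) M = M := by
  have h : inclMatrix R (Function.Embedding.refl ι) = 1 := by
    ext i j
    simp [inclMatrix, one_apply]
  simp [matExt_apply, h]

theorem matExt_trans (e : ι ↪ κ) (f : κ ↪ μ) (M : Matrix ι ι R) :
    matExt f (matExt e M) = matExt (e.trans f) M := by
  simp [matExt_apply, inclMatrix_trans, Matrix.mul_assoc]

theorem sumEmb_trans (e : ι ↪ κ) (f : κ ↪ μ) :
    (sumEmb e).trans (sumEmb f) = sumEmb (e.trans f) := by
  ext (i | i) <;> rfl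

theorem sumEmb_refl : sumEmb (Function.Embedding.refl ι) = Function.Embedding.refl (ι ⊕ ι) := by
  ext (i | i) <;> rfl

/-- The stabilization homomorphism `GQ(ι) → GQ(κ)` along an injection `e` of index sets, which
sends `(a b; c d)` to the matrix whose blocks extend `a`, `d` by the identity and `b`, `c` by
zero. -/
def stab (e : ι ↪ κ) : F.GQ ι →* F.GQ κ :=
  ((Units.map (matExt (sumEmb e))).comp (F.GQ ι).subtype).codRestrict (F.GQ κ) fun σ => by
    rw [mem_GQ_iff]
    have h := mem_GQ_iff.1 σ.2
    change F.IsHerm ((matExt (sumEmb e) (σ.1 : Matrix (ι ⊕ ι) (ι ⊕ ι) R))ᴴ * phi R κ *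
      matExt (sumEmb e) (σ.1 : Matrix (ι ⊕ ι) (ι ⊕ ι) R) - phi R κ)
    generalize (σ.1 : Matrix (ι ⊕ ι) (ι ⊕ ι) R) = s at h ⊢
    convert h.conj (inclMatrix R (sumEmb e))ᴴ using 1
    have h1 : phi R κ * inclMatrix R (sumEmb e) = inclMatrix R (sumEmb e) * phi R ι := by
      simp [phi, inclMatrix_sumEmb, fromBlocks_multiply]
    have h2 : (inclMatrix R (sumEmb e))ᴴ * phi R κ = phi R ι * (inclMatrix R (sumEmb e))ᴴ := by
      simp [phi, inclMatrix_sumEmb, fromBlocks_multiply, fromBlocks_conjTranspose]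
    have h3 := conjTranspose_inclMatrix_mul (R := R) (sumEmb e)
    rw [conjTranspose_matExt, matExt_apply, matExt_apply, conjTranspose_conjTranspose]
    generalize inclMatrix R (sumEmb e) = Q at h1 h2 h3 ⊢
    generalize phi R κ = p at h1 h2 ⊢
    generalize phi R ι = q at h1 h2 ⊢
    have e1 : Q * (sᴴ - 1) * Qᴴ * p = Q * ((sᴴ - 1) * q) * Qᴴ := by
      rw [Matrix.mul_assoc, h2]
      simp only [Matrix.mul_assoc]
    have e2 : p * (Q * (s - 1) * Qᴴ) = Q * (q * (s - 1)) * Qᴴ := by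
      rw [← Matrix.mul_assoc, ← Matrix.mul_assoc, h1]
      simp only [Matrix.mul_assoc]
    have e3 : Q * ((sᴴ - 1) * q) * Qᴴ * (Q * (s - 1) * Qᴴ) =
        Q * ((sᴴ - 1) * q * (s - 1)) * Qᴴ := by
      calc _ = Q * ((sᴴ - 1) * q) * (Qᴴ * Q) * (s - 1) * Qᴴ := by
            simp only [Matrix.mul_assoc]
        _ = _ := by
          rw [h3, Matrix.mul_one]
          simp only [Matrix.mul_assoc]
    have e4 : sᴴ * q * s - q =
        (sᴴ - 1) * q + q * (s - 1) + (sᴴ - 1) * q * (s - 1) := by noncomm_ring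
    rw [Matrix.add_mul, Matrix.one_mul, e1, Matrix.mul_add, Matrix.mul_one, Matrix.add_mul, e2, e3,
      e4]
    simp only [Matrix.mul_add, Matrix.add_mul]
    abel

theorem stab_val (e : ι ↪ κ) (σ : F.GQ ι) :
    ((F.stab e σ).1 : Matrix (κ ⊕ κ) (κ ⊕ κ) R) = matExt (sumEmb e) σ.1 := rfl

theorem GQ_ext {σ τ : F.GQ ι}
    (h : (σ.1 : Matrix (ι ⊕ ι) (ι ⊕ ι) R) = (τ.1 : Matrix (ι ⊕ ι) (ι ⊕ ι) R)) : σ = τ :=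
  Subtype.ext (Units.ext h)

theorem stab_refl (σ : F.GQ ι) : F.stab (Function.Embedding.refl ι) σ = σ :=
  F.GQ_ext (by rw [stab_val, sumEmb_refl, matExt_refl])

theorem stab_trans (e : ι ↪ κ) (f : κ ↪ μ) (σ : F.GQ ι) :
    F.stab f (F.stab e σ) = F.stab (e.trans f) σ :=
  F.GQ_ext (by rw [stab_val, stab_val, stab_val, matExt_trans, sumEmb_trans])

theorem map_matExt_mem_elementaryGroup (e : ι ↪ κ) {u : (Matrix ι ι R)ˣ}
    (hu : u ∈ elementaryGroup R ι) : Units.map (matExt e) u ∈ elementaryGroup R κ := by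
  have h : (elementaryGroup R ι) ≤ (elementaryGroup R κ).comap (Units.map (matExt e)) := by
    refine (Subgroup.closure_le _).2 ?_
    rintro v ⟨i, j, a, hij, hv⟩
    refine Subgroup.subset_closure ⟨e i, e j, a, fun h => hij (e.injective h), ?_⟩
    rw [Units.coe_map, hv, matExt_apply, add_sub_cancel_left]
    congr 1
    ext k l
    simp only [inclMatrix, mul_apply, of_apply, single_apply, conjTranspose_apply]
    by_cases h1 : k = e i <;> by_cases h2 : l = e j <;> simp [h1, h2, eq_comm, ite_and]
  exact h hu

theorem stab_mem_EQ (e : ι ↪ κ) {σ : F.GQ ι} (hσ : σ ∈ F.EQ ι) : F.stab e σ ∈ F.EQ κ := by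
  have h : F.EQ ι ≤ (F.EQ κ).comap (F.stab e) := by
    refine (Subgroup.closure_le _).2 ?_
    rintro v ((⟨ε, hε, rfl⟩ | ⟨β, hβ, rfl⟩) | ⟨γ, hγ, rfl⟩)
    · refine Subgroup.subset_closure
        (Or.inl (Or.inl ⟨_, map_matExt_mem_elementaryGroup e hε, F.GQ_ext ?_⟩))
      rw [stab_val]
      simp only [hyp, matExt_fromBlocks, ← map_inv, ← conjTranspose_matExt]
      simp
    · refine Subgroup.subset_closure
        (Or.inl (Or.inr ⟨inclMatrix R e * β * (inclMatrix R e)ᴴ, ?_, F.GQ_ext ?_⟩))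
      · simpa using hβ.conj (inclMatrix R e)ᴴ
      · rw [stab_val]
        simp only [upper, matExt_fromBlocks]
        simp
    · refine Subgroup.subset_closure
        (Or.inr ⟨inclMatrix R e * γ * (inclMatrix R e)ᴴ, ?_, F.GQ_ext ?_⟩)
      · simpa using hγ.conj (inclMatrix R e)ᴴ
      · rw [stab_val]
        simp only [lower, matExt_fromBlocks]
        simp
  exact h hσ

end Stabilization

/-! ## Normality of the stable elementary group -/

section Whitehead

variable {R : Type*} [Ring R] [StarRing R] (F : FormRing R)
variable {ι : Type*} [Fintype ι] [DecidableEq ι]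

/-- The unipotent matrix `(I x; 0 I)`. -/
def blockUpper (x : Matrix ι ι R) : (Matrix (ι ⊕ ι) (ι ⊕ ι) R)ˣ where
  val := fromBlocks 1 x 0 1
  inv := fromBlocks 1 (-x) 0 1
  val_inv := by simp [fromBlocks_multiply]
  inv_val := by simp [fromBlocks_multiply]

/-- The unipotent matrix `(I 0; x I)`. -/
def blockLower (x : Matrix ι ι R) : (Matrix (ι ⊕ ι) (ι ⊕ ι) R)ˣ where
  val := fromBlocks 1 0 x 1
  inv := fromBlocks 1 0 (-x) 1
  val_inv := by simp [fromBlocks_multiply]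
  inv_val := by simp [fromBlocks_multiply]

theorem blockUpper_mem (x : Matrix ι ι R) : blockUpper x ∈ elementaryGroup R (ι ⊕ ι) := by
  induction x using Matrix.induction_on' with
  | h_zero =>
    convert (elementaryGroup R (ι ⊕ ι)).one_mem using 1
    exact Units.ext (by simp [blockUpper])
  | h_add p q hp hq =>
    convert (elementaryGroup R (ι ⊕ ι)).mul_mem hp hq using 1
    exact Units.ext (by simp [blockUpper, fromBlocks_multiply, add_comm])
  | h_std_basis i j a =>
    refine Subgroup.subset_closure ⟨Sum.inl i, Sum.inr j, a, by simp, ?_⟩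
    ext (k | k) (l | l) <;> simp [blockUpper, one_apply, single_apply]

theorem blockLower_mem (x : Matrix ι ι R) : blockLower x ∈ elementaryGroup R (ι ⊕ ι) := by
  induction x using Matrix.induction_on' with
  | h_zero =>
    convert (elementaryGroup R (ι ⊕ ι)).one_mem using 1
    exact Units.ext (by simp [blockLower])
  | h_add p q hp hq =>
    convert (elementaryGroup R (ι ⊕ ι)).mul_mem hp hq using 1
    exact Units.ext (by simp [blockLower, fromBlocks_multiply])
  | h_std_basis i j a =>
    refine Subgroup.subset_closure ⟨Sum.inr i, Sum.inl j, a, by simp, ?_⟩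
    ext (k | k) (l | l) <;> simp [blockLower, one_apply, single_apply]

theorem hyp_mem {u : (Matrix ι ι R)ˣ} (hu : u ∈ elementaryGroup R ι) : F.hyp u ∈ F.EQ ι :=
  Subgroup.subset_closure (Or.inl (Or.inl ⟨u, hu, rfl⟩))

theorem upper_mem (β : Matrix ι ι R) (hβ : F.bar.IsHerm β) : F.upper β hβ ∈ F.EQ ι :=
  Subgroup.subset_closure (Or.inl (Or.inr ⟨β, hβ, rfl⟩))

theorem lower_mem (γ : Matrix ι ι R) (hγ : F.IsHerm γ) : F.lower γ hγ ∈ F.EQ ι :=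
  Subgroup.subset_closure (Or.inr ⟨γ, hγ, rfl⟩)

theorem isHerm_offDiag (c : Matrix ι ι R) :
    F.IsHerm (fromBlocks 0 c (-(F.lam • cᴴ)) (0 : Matrix ι ι R)) := by
  refine ⟨?_, ?_⟩
  · rw [fromBlocks_conjTranspose, fromBlocks_smul, fromBlocks_neg, conjTranspose_neg,
      F.conjTranspose_lam_smul, smul_neg, smul_smul, F.lam_mul_star]
    simp
  · rintro (i | i) <;> simp

theorem isHerm_diag {c : Matrix ι ι R} (hc : F.IsHerm c) :
    F.IsHerm (fromBlocks (0 : Matrix ι ι R) 0 0 c) := by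
  refine ⟨?_, ?_⟩
  · rw [fromBlocks_conjTranspose, fromBlocks_smul, fromBlocks_neg, ← hc.1]
    simp
  · rintro (i | i)
    · simp
    · simpa using hc.2 i

/-- The block relations satisfied by a `Λ`-quadratic matrix. -/
theorem block_relations (α : F.GQ ι) :
    ∃ a b c d : Matrix ι ι R, (α.1 : Matrix (ι ⊕ ι) (ι ⊕ ι) R) = fromBlocks a b c d ∧
      F.IsHerm (aᴴ * c) ∧ F.IsHerm (bᴴ * d) ∧ aᴴ * d + F.lam • (cᴴ * b) = 1 ∧
      bᴴ * c + F.lam • (dᴴ * a) = F.lam • (1 : Matrix ι ι R) := by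
  have h := α.2
  change F.IsQuadratic _ at h
  generalize (α.1 : Matrix (ι ⊕ ι) (ι ⊕ ι) R) = s at h ⊢
  obtain ⟨h1, h2, h3⟩ := h
  refine ⟨_, _, _, _, (fromBlocks_toBlocks s).symm, ?_⟩
  rw [← fromBlocks_toBlocks s] at h1
  generalize s.toBlocks₁₁ = a at *
  generalize s.toBlocks₁₂ = b at *
  generalize s.toBlocks₂₁ = c at *
  generalize s.toBlocks₂₂ = d at *
  rw [psi, fromBlocks_conjTranspose, fromBlocks_multiply, fromBlocks_multiply,
    fromBlocks_inj] at h1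
  simp only [Matrix.mul_zero, zero_add, add_zero, Matrix.mul_one, F.mul_lam_smul,
    Matrix.smul_mul] at h1
  obtain ⟨e1, e2, e3, e4⟩ := h1
  refine ⟨⟨?_, h2⟩, ⟨?_, h3⟩, ?_, ?_⟩
  · rw [conjTranspose_mul, conjTranspose_conjTranspose, eq_neg_iff_add_eq_zero, add_comm, e1]
  · rw [conjTranspose_mul, conjTranspose_conjTranspose, eq_neg_iff_add_eq_zero, add_comm, e4]
  · rw [add_comm, e2]
  · rw [add_comm, e3]


theorem IsHerm.bar {F : FormRing R} {M : Matrix ι ι R} (hM : F.IsHerm M) :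
    F.bar.IsHerm Mᴴ := by
  refine ⟨?_, fun i => ?_⟩
  · conv_lhs => rw [hM.1]
    rw [conjTranspose_neg, F.conjTranspose_lam_smul]
    rfl
  · change star (star (M i i)) ∈ F.param
    rw [star_star]
    exact hM.2 i

theorem matExt_inl (M : Matrix ι ι R) :
    matExt (Function.Embedding.inl : ι ↪ ι ⊕ ι) M = fromBlocks M 0 0 1 := by
  rw [matExt_apply]
  ext (i | i) (j | j) <;> simp [inclMatrix, mul_apply, one_apply, apply_ite star]

theorem matExt_inr (M : Matrix ι ι R) :
    matExt (Function.Embedding.inr : ι ↪ ι ⊕ ι) M = fromBlocks 1 0 0 M := by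
  rw [matExt_apply]
  ext (i | i) (j | j) <;> simp [inclMatrix, mul_apply, one_apply, apply_ite star]

theorem inclMatrix_inl (M : Matrix ι ι R) :
    inclMatrix R (Function.Embedding.inl : ι ↪ ι ⊕ ι) * M *
      (inclMatrix R (Function.Embedding.inl : ι ↪ ι ⊕ ι))ᴴ = fromBlocks M 0 0 0 := by
  ext (i | i) (j | j) <;> simp [inclMatrix, mul_apply, apply_ite star]

theorem inclMatrix_inr (M : Matrix ι ι R) :
    inclMatrix R (Function.Embedding.inr : ι ↪ ι ⊕ ι) * M *
      (inclMatrix R (Function.Embedding.inr : ι ↪ ι ⊕ ι))ᴴ = fromBlocks 0 0 0 M := by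
  ext (i | i) (j | j) <;> simp [inclMatrix, mul_apply, apply_ite star]

theorem conj_hyp_blockUpper (α : F.GQ ι) :
    F.stab Function.Embedding.inl α * F.hyp (blockUpper 1) *
      (F.stab Function.Embedding.inl α)⁻¹ ∈ F.EQ (ι ⊕ ι) := by
  obtain ⟨a, b, c, d, hα, h1, h2, h3, h4⟩ := F.block_relations α
  have h1' : aᴴ * c + F.lam • (cᴴ * a) = 0 := by
    have h := h1.1
    rw [conjTranspose_mul, conjTranspose_conjTranspose] at h
    rw [← eq_neg_iff_add_eq_zero]
    exact h
  have key : F.stab Function.Embedding.inl α * F.hyp (blockUpper 1) =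
      F.hyp (blockUpper a) * F.lower _ (F.isHerm_offDiag c) * F.lower _ (F.isHerm_diag h1) *
        F.stab Function.Embedding.inl α := by
    refine F.GQ_ext ?_
    simp only [Subgroup.coe_mul, Units.val_mul, stab_val, hα, matExt_fromBlocks, matExt_inl,
      inclMatrix_inl]
    simp only [hyp, lower, blockUpper, Units.inv_mk, fromBlocks_conjTranspose, fromBlocks_multiply]
    simp [fromBlocks_multiply]
    have r1 : aᴴ * c = -(F.lam • (cᴴ * a)) := eq_neg_of_add_eq_zero_left h1'
    have r2 : F.lam • (cᴴ * b) = 1 - aᴴ * d := eq_sub_of_add_eq' h3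
    constructor <;> simp [fromBlocks_add, fromBlocks_multiply, r1, r2]
    abel
  rw [key, mul_inv_cancel_right]
  exact mul_mem (mul_mem (F.hyp_mem (blockUpper_mem a)) (F.lower_mem _ _)) (F.lower_mem _ _)

theorem conj_hyp_blockLower (α : F.GQ ι) :
    F.stab Function.Embedding.inl α * F.hyp (blockLower 1) *
      (F.stab Function.Embedding.inl α)⁻¹ ∈ F.EQ (ι ⊕ ι) := by
  obtain ⟨a, b, c, d, hα, h1, h2, h3, h4⟩ := F.block_relations α
  have key : F.stab Function.Embedding.inl α * F.hyp (blockLower 1) =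
      F.hyp (blockLower dᴴ) * F.upper _ (F.bar.isHerm_offDiag (-b)) *
        F.upper _ (F.bar.isHerm_diag h2.bar) * F.stab Function.Embedding.inl α := by
    refine F.GQ_ext ?_
    simp only [Subgroup.coe_mul, Units.val_mul, stab_val, hα, matExt_fromBlocks, matExt_inl,
      inclMatrix_inl]
    simp only [hyp, upper, blockLower, Units.inv_mk, fromBlocks_conjTranspose, fromBlocks_multiply]
    simp [fromBlocks_multiply]
    have hs : ∀ M N : Matrix ι ι R, M = F.lam • N → star F.lam • M = N := fun M N h => by
      rw [h, smul_smul, F.star_mul_lam, one_smul]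
    have r1 : F.bar.lam • (bᴴ * c) = 1 - dᴴ * a :=
      hs _ _ (by rw [smul_sub, ← h4, add_sub_cancel_right])
    have r2 : F.bar.lam • (bᴴ * d) = -(dᴴ * b) := by
      refine hs _ _ ?_
      conv_lhs => rw [h2.1]
      rw [conjTranspose_mul, conjTranspose_conjTranspose, smul_neg]
    constructor <;> simp [fromBlocks_add, fromBlocks_multiply, r1, r2]
  rw [key, mul_inv_cancel_right]
  exact mul_mem (mul_mem (F.hyp_mem (blockLower_mem _)) (F.upper_mem _ _)) (F.upper_mem _ _)

theorem hyp_mul (u v : (Matrix ι ι R)ˣ) : F.hyp (u * v) = F.hyp u * F.hyp v := by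
  refine F.GQ_ext ?_
  simp [hyp, fromBlocks_multiply]

/-- The homomorphism `u ↦ H(u)`. -/
def hypHom : (Matrix ι ι R)ˣ →* F.GQ ι := MonoidHom.mk' F.hyp F.hyp_mul

/-- The block rotation `(0 -I; I 0)`. -/
def rot : (Matrix (ι ⊕ ι) (ι ⊕ ι) R)ˣ := (blockUpper 1)⁻¹ * blockLower 1 * (blockUpper 1)⁻¹

theorem rot_conj (α : F.GQ ι) :
    F.stab Function.Embedding.inr α * F.hyp rot =
      F.hyp rot * F.stab Function.Embedding.inl α := by
  obtain ⟨a, b, c, d, hα, -⟩ := F.block_relations α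
  refine F.GQ_ext ?_
  simp only [Subgroup.coe_mul, Units.val_mul, stab_val, hα, matExt_fromBlocks, matExt_inl,
    inclMatrix_inl, matExt_inr, inclMatrix_inr]
  simp [hyp, rot, blockUpper, blockLower, fromBlocks_multiply, fromBlocks_conjTranspose]

theorem whitehead (α : F.GQ ι) :
    F.stab Function.Embedding.inl α * (F.stab Function.Embedding.inr α)⁻¹ ∈ F.EQ (ι ⊕ ι) := by
  have hr : F.hyp (rot : (Matrix (ι ⊕ ι) (ι ⊕ ι) R)ˣ) ∈ F.EQ (ι ⊕ ι) := F.hyp_mem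
    (mul_mem (mul_mem (inv_mem (blockUpper_mem 1)) (blockLower_mem 1))
      (inv_mem (blockUpper_mem 1)))
  have h0 : (F.hyp (rot : (Matrix (ι ⊕ ι) (ι ⊕ ι) R)ˣ))=
      (F.hyp (blockUpper 1))⁻¹ * F.hyp (blockLower 1) * (F.hyp (blockUpper 1))⁻¹ := by
    change F.hypHom _ = (F.hypHom _)⁻¹ * F.hypHom _ * (F.hypHom _)⁻¹
    rw [rot, map_mul, map_mul, map_inv]
  have h1 := F.conj_hyp_blockUpper α
  have h2 := F.conj_hyp_blockLower α
  have h3 := F.rot_conj α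
  generalize F.stab (Function.Embedding.inl : ι ↪ ι ⊕ ι) α = A at *
  generalize F.stab (Function.Embedding.inr : ι ↪ ι ⊕ ι) α = B at *
  have h4 : A * B⁻¹ = ((A * F.hyp (blockUpper 1) * A⁻¹)⁻¹ * (A * F.hyp (blockLower 1) * A⁻¹) *
      (A * F.hyp (blockUpper 1) * A⁻¹)⁻¹) * (F.hyp rot)⁻¹ := by
    have h5 : B = F.hyp rot * A * (F.hyp rot)⁻¹ := by rw [← h3, mul_inv_cancel_right]
    rw [h5, h0]
    group
  rw [h4]
  exact mul_mem (mul_mem (mul_mem (inv_mem h1) h2) (inv_mem h1)) (inv_mem hr)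

theorem stab_conj_mem (α ε : F.GQ ι) (hε : ε ∈ F.EQ ι) :
    F.stab Function.Embedding.inl (α * ε * α⁻¹) ∈ F.EQ (ι ⊕ ι) := by
  have hc : F.stab Function.Embedding.inr α * F.stab Function.Embedding.inl ε =
      F.stab Function.Embedding.inl ε * F.stab Function.Embedding.inr α := by
    obtain ⟨a, b, c, d, hα, -⟩ := F.block_relations α
    obtain ⟨a', b', c', d', hε', -⟩ := F.block_relations ε
    refine F.GQ_ext ?_
    simp only [Subgroup.coe_mul, Units.val_mul, stab_val, hα, hε', matExt_fromBlocks, matExt_inl,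
      inclMatrix_inl, matExt_inr, inclMatrix_inr]
    simp [fromBlocks_multiply, add_comm]
  have h1 := F.whitehead α
  have h2 := F.stab_mem_EQ (Function.Embedding.inl : ι ↪ ι ⊕ ι) hε
  rw [map_mul, map_mul, map_inv]
  generalize F.stab (Function.Embedding.inl : ι ↪ ι ⊕ ι) α = A at *
  generalize F.stab (Function.Embedding.inr : ι ↪ ι ⊕ ι) α = B at *
  generalize F.stab (Function.Embedding.inl : ι ↪ ι ⊕ ι) ε = e at *
  have h3 : A * e * A⁻¹ = (A * B⁻¹) * e * (A * B⁻¹)⁻¹ := by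
    have h4 : e = B * e * B⁻¹ := by rw [hc, mul_inv_cancel_right]
    conv_lhs => rw [show e = B⁻¹ * e * B by rw [mul_assoc, ← hc, inv_mul_cancel_left]]
    group
  rw [h3]
  exact mul_mem (mul_mem h1 h2) (inv_mem h1)

end Whitehead

/-! ## Stable groups, `K₁` and `NK₁` -/

section Stable

variable {R : Type*} [Ring R] [StarRing R] (F : FormRing R)

/-- The stabilization `GQ(2m, R, Λ) → GQ(2n, R, Λ)` for `m ≤ n`. -/
def stabLE (m n : ℕ) (h : m ≤ n) : F.GQ (Fin m) →* F.GQ (Fin n) := F.stab (Fin.castLEEmb h)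

instance directedSystem_GQ :
    DirectedSystem (fun n : ℕ => F.GQ (Fin n)) (fun m n h => F.stabLE m n h) where
  map_self _ σ := F.stab_refl σ
  map_map _ _ _ _ _ σ := F.stab_trans _ _ σ

/-- The stable group `GQ(R, Λ)`, the direct limit of the groups `GQ(2n, R, Λ)`. -/
abbrev StableGQ : Type _ := DirectLimit (fun n : ℕ => F.GQ (Fin n)) F.stabLE

/-- The canonical homomorphism `GQ(2n, R, Λ) → GQ(R, Λ)`. -/
noncomputable def toStable (n : ℕ) : F.GQ (Fin n) →* F.StableGQ where
  toFun σ := ⟦⟨n, σ⟩⟧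
  map_one' := (DirectLimit.one_def n).symm
  map_mul' σ τ := (DirectLimit.mul_def (G := fun n : ℕ => F.GQ (Fin n)) (f := F.stabLE) n σ τ).symm

theorem toStable_stabLE (m n : ℕ) (h : m ≤ n) (σ : F.GQ (Fin m)) :
    F.toStable n (F.stabLE m n h σ) = F.toStable m σ :=
  DirectLimit.mk_apply (F := fun n : ℕ => F.GQ (Fin n)) (f := F.stabLE) m n σ h

/-- The stable elementary group `EQ(R, Λ)`, the union of the images of the `EQ(2n, R, Λ)`. -/
noncomputable def StableEQ : Subgroup F.StableGQ := ⨆ n : ℕ, (F.EQ (Fin n)).map (F.toStable n)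

theorem toStable_mem {n : ℕ} {σ : F.GQ (Fin n)} (h : σ ∈ F.EQ (Fin n)) :
    F.toStable n σ ∈ F.StableEQ :=
  le_iSup (fun n : ℕ => (F.EQ (Fin n)).map (F.toStable n)) n ⟨σ, h, rfl⟩

instance stableEQ_normal : F.StableEQ.Normal where
  conj_mem x hx g := by
    have h : F.StableEQ ≤ F.StableEQ.comap (MulAut.conj g).toMonoidHom := by
      refine iSup_le fun n => ?_
      rintro _ ⟨ε, hε, rfl⟩
      obtain ⟨m, α, rfl⟩ := DirectLimit.exists_eq_mk F.stabLE g
      change F.toStable m α * F.toStable n ε * (F.toStable m α)⁻¹ ∈ F.StableEQ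
      rw [← F.toStable_stabLE m (max m n) (le_max_left m n) α,
        ← F.toStable_stabLE n (max m n) (le_max_right m n) ε, ← map_inv, ← map_mul, ← map_mul]
      have hε' : F.stabLE n (max m n) (le_max_right m n) ε ∈ F.EQ _ := F.stab_mem_EQ _ hε
      generalize F.stabLE n (max m n) (le_max_right m n) ε = e at hε' ⊢
      generalize F.stabLE m (max m n) (le_max_left m n) α = a
      generalize max m n = N at *
      have h1 := F.stab_mem_EQ finSumFinEquiv.toEmbedding (F.stab_conj_mem a e hε')
      rw [stab_trans] at h1
      have h2 : (Function.Embedding.inl : Fin N ↪ Fin N ⊕ Fin N).trans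
          finSumFinEquiv.toEmbedding = Fin.castLEEmb (Nat.le_add_right N N) := by
        ext i
        simp
      rw [h2] at h1
      rw [← F.toStable_stabLE N (N + N) (Nat.le_add_right N N)]
      exact F.toStable_mem h1
    exact h hx

/-- The unitary Whitehead group `K₁GQ(R, Λ) = GQ(R, Λ) / EQ(R, Λ)`. -/
abbrev K1GQ : Type _ := F.StableGQ ⧸ F.StableEQ

/-- The class `[α]` in `K₁GQ(R, Λ)` of `α` in `GQ(2n, R, Λ)`. -/
noncomputable def cls {n : ℕ} (α : F.GQ (Fin n)) : F.K1GQ := QuotientGroup.mk (F.toStable n α)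

end Stable

section Functoriality

variable {R S : Type*} [Ring R] [StarRing R] [Ring S] [StarRing S]

/-- A homomorphism of form rings: a ring homomorphism compatible with the involutions, the
central elements and the form parameters. -/
structure Hom (F : FormRing R) (G : FormRing S) where
  toRingHom : R →+* S
  map_star : ∀ x, toRingHom (star x) = star (toRingHom x)
  map_lam : toRingHom F.lam = G.lam
  map_param : ∀ a ∈ F.param, toRingHom a ∈ G.param

variable {F : FormRing R} {G : FormRing S} (f : Hom F G)
variable {ι κ : Type*} [Fintype ι] [DecidableEq ι] [Fintype κ] [DecidableEq κ]

theorem Hom.conjTranspose_map {m n : Type*} (M : Matrix m n R) :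
    Mᴴ.map f.toRingHom = (M.map f.toRingHom)ᴴ := by
  ext i j
  simp [f.map_star]

theorem Hom.isHerm {n : Type*} {M : Matrix n n R} (hM : F.IsHerm M) :
    G.IsHerm (M.map f.toRingHom) := by
  refine ⟨?_, fun i => f.map_param _ (hM.2 i)⟩
  conv_lhs => rw [hM.1]
  ext i j
  simp [f.map_star, f.map_lam]

/-- The induced homomorphism of form rings `(R, star λ, star Λ) → (S, star μ, star Γ)`. -/
def Hom.bar : Hom F.bar G.bar where
  toRingHom := f.toRingHom
  map_star := f.map_star
  map_lam := by
    change f.toRingHom (star F.lam) = star G.lam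
    rw [f.map_star, f.map_lam]
  map_param a ha := by
    change star (f.toRingHom a) ∈ G.param
    rw [← f.map_star]
    exact f.map_param _ ha

/-- The homomorphism `GQ(2n, R, Λ) → GQ(2n, S, Γ)` applying `f` to the entries. -/
def Hom.mapGQ (ι : Type*) [Fintype ι] [DecidableEq ι] : F.GQ ι →* G.GQ ι :=
  ((Units.map (f.toRingHom.mapMatrix (m := ι ⊕ ι)).toMonoidHom).comp
    (F.GQ ι).subtype).codRestrict (G.GQ ι) fun σ => by
    rw [mem_GQ_iff]
    have h := f.isHerm (mem_GQ_iff.1 σ.2)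
    convert h using 1
    have hp : phi S ι = (phi R ι).map f.toRingHom := by
      simp [phi, fromBlocks_map, Matrix.map_one]
    change ((σ.1 : Matrix (ι ⊕ ι) (ι ⊕ ι) R).map f.toRingHom)ᴴ * phi S ι *
      (σ.1 : Matrix (ι ⊕ ι) (ι ⊕ ι) R).map f.toRingHom - phi S ι = _
    rw [Matrix.map_sub _ (map_sub f.toRingHom), Matrix.map_mul, Matrix.map_mul,
      f.conjTranspose_map, hp]

theorem Hom.mapGQ_val (σ : F.GQ ι) :
    ((f.mapGQ ι σ).1 : Matrix (ι ⊕ ι) (ι ⊕ ι) S) =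
      (σ.1 : Matrix (ι ⊕ ι) (ι ⊕ ι) R).map f.toRingHom := rfl

theorem Hom.mapGQ_stab (e : ι ↪ κ) (σ : F.GQ ι) :
    f.mapGQ κ (F.stab e σ) = G.stab e (f.mapGQ ι σ) := by
  refine G.GQ_ext ?_
  have hp : inclMatrix S (sumEmb e) = (inclMatrix R (sumEmb e)).map f.toRingHom := by
    ext i j
    simp [inclMatrix, apply_ite f.toRingHom]
  rw [f.mapGQ_val, stab_val, stab_val, f.mapGQ_val, matExt_apply, matExt_apply, hp,
    Matrix.map_add _ (map_add f.toRingHom), Matrix.map_mul, Matrix.map_mul,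
    Matrix.map_sub _ (map_sub f.toRingHom), f.conjTranspose_map]
  simp [Matrix.map_one]

theorem Hom.mapGQ_mem_EQ {σ : F.GQ ι} (hσ : σ ∈ F.EQ ι) : f.mapGQ ι σ ∈ G.EQ ι := by
  have h : F.EQ ι ≤ (G.EQ ι).comap (f.mapGQ ι) := by
    refine (Subgroup.closure_le _).2 ?_
    rintro v ((⟨ε, hε, rfl⟩ | ⟨β, hβ, rfl⟩) | ⟨γ, hγ, rfl⟩)
    · have h1 : elementaryGroup R ι ≤ (elementaryGroup S ι).comap
          (Units.map (f.toRingHom.mapMatrix (m := ι)).toMonoidHom) := by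
        refine (Subgroup.closure_le _).2 ?_
        rintro v ⟨i, j, a, hij, hv⟩
        refine Subgroup.subset_closure ⟨i, j, f.toRingHom a, hij, ?_⟩
        change (v : Matrix ι ι R).map f.toRingHom = _
        rw [hv, Matrix.map_add _ (map_add f.toRingHom)]
        simp [Matrix.map_one]
      refine Subgroup.subset_closure (Or.inl (Or.inl ⟨_, h1 hε, G.GQ_ext ?_⟩))
      rw [f.mapGQ_val]
      simp only [hyp, fromBlocks_map, f.conjTranspose_map, ← map_inv]
      simp
    · refine Subgroup.subset_closure
        (Or.inl (Or.inr ⟨β.map f.toRingHom, f.bar.isHerm hβ, G.GQ_ext ?_⟩))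
      rw [f.mapGQ_val]
      simp [upper, fromBlocks_map, Matrix.map_one]
    · refine Subgroup.subset_closure
        (Or.inr ⟨γ.map f.toRingHom, f.isHerm hγ, G.GQ_ext ?_⟩)
      rw [f.mapGQ_val]
      simp [lower, fromBlocks_map, Matrix.map_one]
  exact h hσ

/-- The induced homomorphism of stable groups `GQ(R, Λ) → GQ(S, Γ)`. -/
noncomputable def Hom.mapStable : F.StableGQ →* G.StableGQ where
  toFun := DirectLimit.lift F.stabLE (fun n σ => G.toStable n (f.mapGQ (Fin n) σ))
    fun m n h σ => by
      change _ = G.toStable n (f.mapGQ (Fin n) (F.stab (Fin.castLEEmb h) σ))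
      rw [f.mapGQ_stab]
      exact (G.toStable_stabLE m n h _).symm
  map_one' := by
    have h : (1 : F.StableGQ) = ⟦⟨0, 1⟩⟧ := (map_one (F.toStable 0)).symm
    rw [h]
    change G.toStable 0 (f.mapGQ (Fin 0) 1) = 1
    rw [map_one, map_one]
  map_mul' x y := by
    obtain ⟨n, σ, τ, rfl, rfl⟩ := DirectLimit.exists_eq_mk₂ F.stabLE x y
    have h : (⟦⟨n, σ⟩⟧ * ⟦⟨n, τ⟩⟧ : F.StableGQ) = ⟦⟨n, σ * τ⟩⟧ :=
      (map_mul (F.toStable n) σ τ).symm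
    rw [h]
    change G.toStable n (f.mapGQ (Fin n) (σ * τ)) =
      G.toStable n (f.mapGQ (Fin n) σ) * G.toStable n (f.mapGQ (Fin n) τ)
    rw [map_mul, map_mul]

theorem Hom.mapStable_toStable (n : ℕ) (σ : F.GQ (Fin n)) :
    f.mapStable (F.toStable n σ) = G.toStable n (f.mapGQ (Fin n) σ) := rfl

theorem Hom.stableEQ_le : F.StableEQ ≤ G.StableEQ.comap f.mapStable := by
  refine iSup_le fun n => ?_
  rintro _ ⟨ε, hε, rfl⟩
  change f.mapStable _ ∈ G.StableEQ
  rw [f.mapStable_toStable]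
  exact G.toStable_mem (f.mapGQ_mem_EQ hε)

/-- The induced homomorphism `K₁GQ(R, Λ) → K₁GQ(S, Γ)`. -/
noncomputable def Hom.mapK1 : F.K1GQ →* G.K1GQ :=
  QuotientGroup.map F.StableEQ G.StableEQ f.mapStable f.stableEQ_le

/-- The homomorphism of form rings `(R[X], Λ[X]) → (R, Λ)` given by `X ↦ 0`. -/
noncomputable def evalZero (F : FormRing R) : Hom F.poly F where
  toRingHom := constantCoeff
  map_star p := rfl
  map_lam := by simp [poly]
  map_param p hp := hp 0

/-- The unitary nil-group `NK₁GQ(R, Λ)`, the kernel of `K₁GQ(R[X], Λ[X]) → K₁GQ(R, Λ)`. -/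
noncomputable def NK1GQ (F : FormRing R) : Subgroup F.poly.K1GQ := F.evalZero.mapK1.ker

end Functoriality

end FormRing

/-! Since `A(X)` is invertible, block elimination writes `α` as a lower unipotent times `H(A)` times
an upper unipotent, so `[α] = [H(A)]` (`clsHom_eq_hypCls`). Higman's trick, available because `[α]`
dies at `X = 0`, replaces `A` by `1 - XN` with `N` nilpotent over `R`
(`exists_nilpotent_of_mem_NK1GQ`). It remains to show that `[H(1 - XN)]^k = 1` forces `[H(1 - XN)] =
1`.

Let `A₀` be the commutative ring of central self-adjoint elements preserving `Λ`. It contains `1/k`,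
so modulo any power of `X` the polynomial `1 - X` is the `k`-th power of a finite product `f` of
factors `1 - a X^(n+1)` with `a` in `A₀` (`exists_truncated_root`). Substituting `XN`, which is
nilpotent, gives the exact equality `1 - XN = f(XN)^k`. Hence it suffices that every factor `1 - a
X^(n+1) N^(n+1)` has a class killed by `k` (`exists_hypCls_pow_eq_one`): then `[H(1 - XN)] =
[H(f(XN))]^k = 1`.

Such a factor is obtained from `1 - XN` by a transfer. Send `X` to the companion matrix `S` of
`T^(n+1) - a X^(n+1)`, which gives a ring homomorphism from `R[X]` to matrices over `R[X]`. The
antidiagonal matrix `J` satisfies `J S* J = S`, so the homomorphism respects the involutions up to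
`J`. After untwisting by `J` it carries elementary quadratic matrices to elementary ones, hence
trivial hyperbolic classes to trivial ones (`Transfer.hypCls_expand_eq_one`). It maps `1 - XN` to `1
- N ⊗ S`, and the Sylvester identity `[1 - UV] = [1 - VU]` reduces that to `1 - a X^(n+1) N^(n+1)`
(`hypCls_one_sub_shift`). -/

namespace FormRing

set_option linter.unusedSectionVars false

/-! ### Unipotent matrices in the elementary group -/

section Elementary

variable {R : Type*} [Ring R] {ι κ : Type*} [Fintype ι] [DecidableEq ι] [Fintype κ] [DecidableEq κ]

/-- The unit `1 + M` for a matrix `M` of square zero. -/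
def oneAddUnit (M : Matrix κ κ R) (h : M * M = 0) : (Matrix κ κ R)ˣ where
  val := 1 + M
  inv := 1 - M
  val_inv := by rw [add_mul, mul_sub, mul_sub, h]; simp
  inv_val := by rw [sub_mul, mul_add, mul_add, h]; simp

/-- The nonzero entries go from rows in `p` to columns outside `p`, so any two of the corresponding
single-entry matrices multiply to zero and `1 + M` is the product of the transvections of its
entries. -/
theorem mem_elementaryGroup_of_block (p : κ → Prop) (M : Matrix κ κ R)
    (hM : ∀ x y, M x y ≠ 0 → p x ∧ ¬ p y) (u : (Matrix κ κ R)ˣ)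
    (hu : (u : Matrix κ κ R) = 1 + M) : u ∈ elementaryGroup R κ := by
  classical
  have key : ∀ s : Finset (κ × κ), (∀ z ∈ s, p z.1 ∧ ¬ p z.2) →
      ∃ v ∈ elementaryGroup R κ,
        (v : Matrix κ κ R) = 1 + ∑ z ∈ s, single z.1 z.2 (M z.1 z.2) := by
    intro s
    induction s using Finset.induction_on with
    | empty => exact fun _ => ⟨1, one_mem _, by simp⟩
    | insert z s hz ih =>
      intro h
      obtain ⟨v, hv, hv'⟩ := ih fun y hy => h y (Finset.mem_insert_of_mem hy)
      have hz' := h z (Finset.mem_insert_self _ _)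
      have hne : z.1 ≠ z.2 := fun e => hz'.2 (e ▸ hz'.1)
      refine ⟨oneAddUnit (single z.1 z.2 (M z.1 z.2)) (by simp [hne.symm]) * v,
        mul_mem (Subgroup.subset_closure ⟨z.1, z.2, _, hne, rfl⟩) hv, ?_⟩
      rw [Units.val_mul, hv', Finset.sum_insert hz]
      have h0 : single z.1 z.2 (M z.1 z.2) * ∑ y ∈ s, single y.1 y.2 (M y.1 y.2) = 0 := by
        rw [Finset.mul_sum]
        refine Finset.sum_eq_zero fun y hy => ?_
        have : z.2 ≠ y.1 := fun e =>
          hz'.2 (e ▸ (h y (Finset.mem_insert_of_mem hy)).1)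
        simp [this]
      change (1 + single z.1 z.2 (M z.1 z.2)) * _ = _
      rw [mul_add, add_mul, add_mul, h0]
      simp only [mul_one, one_mul, add_zero]
      abel
  obtain ⟨v, hv, hv'⟩ := key (Finset.univ.filter fun z => M z.1 z.2 ≠ 0)
    fun z hz => hM _ _ (Finset.mem_filter.1 hz).2
  have h1 : u = v := by
    refine Units.ext ?_
    rw [hu, hv', Finset.sum_filter_of_ne]
    · congr 1
      conv_lhs => rw [matrix_eq_sum_single M]
      rw [← Finset.sum_product']
      rfl
    · intro z _ hz h0
      exact hz (by rw [h0, single_zero])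
  rwa [h1]

/-- Matrices which are triangular with respect to a height function and have ones on the diagonal
are elementary. -/
theorem mem_elementaryGroup_of_triangular (f : κ → ℕ) (M : Matrix κ κ R)
    (hM : ∀ x y, M x y ≠ 0 → f y < f x) :
    ∃ u ∈ elementaryGroup R κ, (u : Matrix κ κ R) = 1 + M := by
  classical
  have key : ∀ n : ℕ, ∀ M : Matrix κ κ R, (∀ x y, M x y ≠ 0 → f y < f x ∧ f x < n) →
      ∃ u ∈ elementaryGroup R κ, (u : Matrix κ κ R) = 1 + M := by
    intro n
    induction n with
    | zero =>
      intro M h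
      refine ⟨1, one_mem _, ?_⟩
      have : M = 0 := by
        ext x y
        by_contra h0
        exact absurd (h x y h0).2 (Nat.not_lt_zero _)
      simp [this]
    | succ n ih =>
      intro M h
      -- Split off the rows of top height. The columns of `M₁` and `M₂` have height below `n`, where
      -- `M₂` has no rows; thus `M₁ M₂ = M₂ M₂ = 0` and `1 + M = (1 + M₁)(1 + M₂)`.
      let M₁ : Matrix κ κ R := Matrix.of fun x y => if f x < n then M x y else 0
      let M₂ : Matrix κ κ R := Matrix.of fun x y => if f x < n then 0 else M x y
      have hsum : M = M₁ + M₂ := by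
        ext x y
        by_cases hx : f x < n <;> simp [M₁, M₂, hx]
      have h₁ : ∀ x y, M₁ x y ≠ 0 → f y < f x ∧ f x < n := by
        intro x y hxy
        by_cases hx : f x < n
        · exact ⟨(h x y (by simpa [M₁, hx] using hxy)).1, hx⟩
        · simp [M₁, hx] at hxy
      have h₂ : ∀ x y, M₂ x y ≠ 0 → ¬ f x < n ∧ f y < n := by
        intro x y hxy
        by_cases hx : f x < n
        · simp [M₂, hx] at hxy
        · have := h x y (by simpa [M₂, hx] using hxy)
          exact ⟨hx, by omega⟩
      have h12 : ∀ N : Matrix κ κ R, (∀ x y, N x y ≠ 0 → f y < n) → N * M₂ = 0 := by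
        intro N hN
        ext x z
        rw [mul_apply]
        refine Finset.sum_eq_zero fun y _ => ?_
        by_cases h0 : N x y = 0
        · rw [h0, zero_mul]
        · simp [M₂, hN x y h0]
      obtain ⟨u, hu, hu'⟩ := ih M₁ h₁
      refine ⟨u * oneAddUnit M₂ (h12 _ fun x y hxy => (h₂ x y hxy).2), mul_mem hu
        (mem_elementaryGroup_of_block (fun x => ¬ f x < n) M₂
          (fun x y hxy => ⟨(h₂ x y hxy).1, fun hy => hy (h₂ x y hxy).2⟩) _ rfl), ?_⟩
      change (u : Matrix κ κ R) * (1 + M₂) = _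
      have h3 := h12 M₁ fun x y hxy => (h₁ x y hxy).1.trans (h₁ x y hxy).2
      rw [hu', hsum, mul_add, add_mul _ _ M₂, h3]
      simp [add_assoc]
  refine key (Finset.univ.sup f + 1) M fun x y hxy =>
    ⟨hM x y hxy, Nat.lt_succ_of_le (Finset.le_sup (Finset.mem_univ x))⟩

end Elementary

/-! ### Classes for arbitrary finite index types, and reduction to hyperbolic matrices -/

section Class

variable {R : Type*} [Ring R] [StarRing R] (F : FormRing R)
variable {ι κ : Type*} [Fintype ι] [DecidableEq ι] [Fintype κ] [DecidableEq κ]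

/-- The class in `K₁GQ(R, Λ)` of a quadratic matrix indexed by an arbitrary finite type. -/
noncomputable def clsHom (ι : Type*) [Fintype ι] [DecidableEq ι] : F.GQ ι →* F.K1GQ :=
  ((QuotientGroup.mk' F.StableEQ).comp (F.toStable (Fintype.card ι))).comp
    (F.stab (Fintype.equivFin ι).toEmbedding)

theorem cls_stabLE {m n : ℕ} (h : m ≤ n) (σ : F.GQ (Fin m)) :
    F.cls (F.stab (Fin.castLEEmb h) σ) = F.cls σ :=
  congrArg _ (F.toStable_stabLE m n h σ)

theorem cls_eq_one_of_mem {n : ℕ} {σ : F.GQ (Fin n)} (h : σ ∈ F.EQ (Fin n)) : F.cls σ = 1 :=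
  (QuotientGroup.eq_one_iff _).2 (F.toStable_mem h)

theorem cls_mul {n : ℕ} (σ τ : F.GQ (Fin n)) : F.cls (σ * τ) = F.cls σ * F.cls τ := by
  simp [cls]

theorem cls_inv {n : ℕ} (σ : F.GQ (Fin n)) : F.cls σ⁻¹ = (F.cls σ)⁻¹ := by
  simp [cls]

/-- Disjoint embeddings combine into one embedding of `ι ⊕ ι`, along which `whitehead` is
transported. -/
theorem cls_stab_disjoint {n : ℕ} (e e' : ι ↪ Fin n) (h : ∀ i j, e i ≠ e' j) (σ : F.GQ ι) :
    F.cls (F.stab e σ) = F.cls (F.stab e' σ) := by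
  let g : ι ⊕ ι ↪ Fin n := ⟨Sum.elim e e', e.injective.sumElim e'.injective h⟩
  have h1 := F.cls_eq_one_of_mem (F.stab_mem_EQ g (F.whitehead σ))
  rw [map_mul, map_inv, stab_trans, stab_trans, cls_mul, cls_inv] at h1
  exact mul_inv_eq_one.1 h1

theorem cls_stab_eq {m n : ℕ} (e : ι ↪ Fin m) (e' : ι ↪ Fin n) (σ : F.GQ ι) :
    F.cls (F.stab e σ) = F.cls (F.stab e' σ) := by
  let l := Fintype.card ι
  -- A third embedding, landing beyond `max m n` and so disjoint from both given ones.
  let d : ι ↪ Fin (max m n + l) :=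
    (Fintype.equivFin ι).toEmbedding.trans (Fin.natAddEmb (max m n))
  have key : ∀ (k : ℕ) (hk : k ≤ max m n) (f : ι ↪ Fin k),
      F.cls (F.stab f σ) = F.cls (F.stab d σ) := by
    intro k hk f
    rw [← F.cls_stabLE (hk.trans (Nat.le_add_right _ l)), stab_trans]
    refine F.cls_stab_disjoint _ _ (fun i j hij => ?_) σ
    have := congrArg Fin.val hij
    simp [d] at this
    omega
  rw [key m (le_max_left _ _) e, key n (le_max_right _ _) e']

theorem clsHom_eq {n : ℕ} (e : ι ↪ Fin n) (σ : F.GQ ι) : F.clsHom ι σ = F.cls (F.stab e σ) :=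
  F.cls_stab_eq _ _ _

theorem clsHom_fin {n : ℕ} (σ : F.GQ (Fin n)) : F.clsHom (Fin n) σ = F.cls σ := by
  rw [F.clsHom_eq (Function.Embedding.refl _), stab_refl]

theorem clsHom_stab (e : ι ↪ κ) (σ : F.GQ ι) : F.clsHom κ (F.stab e σ) = F.clsHom ι σ := by
  rw [F.clsHom_eq (Fintype.equivFin κ).toEmbedding, stab_trans, ← clsHom_eq]

theorem clsHom_eq_one_of_mem {σ : F.GQ ι} (h : σ ∈ F.EQ ι) : F.clsHom ι σ = 1 := by
  rw [F.clsHom_eq (Fintype.equivFin ι).toEmbedding]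
  exact F.cls_eq_one_of_mem (F.stab_mem_EQ _ h)

/-- The images of the finite elementary groups form a directed family, and an equality in the direct
limit already holds at a finite stage. -/
theorem exists_stab_mem_EQ {σ : F.GQ ι} (h : F.clsHom ι σ = 1) :
    ∃ (n : ℕ) (e : ι ↪ Fin n), F.stab e σ ∈ F.EQ (Fin n) := by
  have h1 : F.toStable _ (F.stab (Fintype.equivFin ι).toEmbedding σ) ∈ F.StableEQ :=
    (QuotientGroup.eq_one_iff _).1 h
  have hdir : Directed (· ≤ ·) fun n : ℕ => (F.EQ (Fin n)).map (F.toStable n) := by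
    refine directed_of_isDirected_le fun m n hmn => ?_
    rintro _ ⟨ε, hε, rfl⟩
    exact ⟨F.stabLE m n hmn ε, F.stab_mem_EQ _ hε, F.toStable_stabLE _ _ _ _⟩
  rw [StableEQ, Subgroup.mem_iSup_of_directed hdir] at h1
  obtain ⟨n, ε, hε, h2⟩ := h1
  have h3 : (⟦⟨n, ε⟩⟧ : F.StableGQ) = ⟦⟨_, F.stab (Fintype.equivFin ι).toEmbedding σ⟩⟧ := h2
  obtain ⟨N, hn, hι, h4⟩ := Quotient.exact h3
  refine ⟨N, (Fintype.equivFin ι).toEmbedding.trans (Fin.castLEEmb hι), ?_⟩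
  rw [← stab_trans]
  change F.stabLE _ _ hn ε = F.stabLE _ _ hι _ at h4
  change F.stabLE _ _ hι _ ∈ _
  rw [← h4]
  exact F.stab_mem_EQ _ hε

/-- The class of the hyperbolic matrix `H(u)`. -/
noncomputable def hypCls (ι : Type*) [Fintype ι] [DecidableEq ι] :
    (Matrix ι ι R)ˣ →* F.K1GQ := (F.clsHom ι).comp F.hypHom

theorem hypCls_apply (u : (Matrix ι ι R)ˣ) : F.hypCls ι u = F.clsHom ι (F.hyp u) := rfl

theorem hypCls_eq_one_of_mem {u : (Matrix ι ι R)ˣ} (h : u ∈ elementaryGroup R ι) :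
    F.hypCls ι u = 1 := F.clsHom_eq_one_of_mem (F.hyp_mem h)

theorem stab_hyp (e : ι ↪ κ) (u : (Matrix ι ι R)ˣ) :
    F.stab e (F.hyp u) = F.hyp (Units.map (matExt e) u) := by
  refine F.GQ_ext ?_
  rw [stab_val]
  simp only [hyp, matExt_fromBlocks, ← map_inv, ← conjTranspose_matExt]
  simp

theorem hypCls_matExt (e : ι ↪ κ) (u : (Matrix ι ι R)ˣ) :
    F.hypCls κ (Units.map (matExt e) u) = F.hypCls ι u := by
  rw [hypCls_apply, ← stab_hyp, clsHom_stab, hypCls_apply]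

/-- With `u` the invertible upper left block, `σ = T₂₁(c u⁻¹) H(u) T₁₂(u⁻¹ b)`. Conjugating the
Hermitian matrix `u* c` by `u⁻¹` shows that `c u⁻¹` is Hermitian. Once `c` is cleared, the quadratic
relations force the last block to be `(u*)⁻¹` and make `u⁻¹ b` Hermitian for the opposite form ring.
-/
theorem clsHom_eq_hypCls (σ : F.GQ ι) (u : (Matrix ι ι R)ˣ)
    (hu : (u : Matrix ι ι R) = (σ.1 : Matrix (ι ⊕ ι) (ι ⊕ ι) R).toBlocks₁₁) :
    F.clsHom ι σ = F.hypCls ι u := by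
  obtain ⟨a, b, c, d, hσ, h1, h2, h3, h4⟩ := F.block_relations σ
  have ha : a = u := by rw [hu, hσ, toBlocks_fromBlocks₁₁]
  subst ha
  set v : Matrix ι ι R := ((u⁻¹ : (Matrix ι ι R)ˣ) : Matrix ι ι R) with hv
  have huv : (u : Matrix ι ι R) * v = 1 := u.mul_inv
  have hvu : v * (u : Matrix ι ι R) = 1 := u.inv_mul
  have hvs : vᴴ * (u : Matrix ι ι R)ᴴ = 1 := by rw [← conjTranspose_mul, huv, conjTranspose_one]
  have hγ : F.IsHerm (c * v) := by
    have := h1.conj v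
    rwa [← Matrix.mul_assoc, hvs, Matrix.one_mul] at this
  obtain ⟨a', b', c', d', hτ, k1, k2, k3, k4⟩ := F.block_relations (F.lower (-(c * v)) hγ.neg * σ)
  have hval : fromBlocks a' b' c' d' = fromBlocks (u : Matrix ι ι R) b 0 (d - c * v * b) := by
    rw [← hτ, Subgroup.coe_mul, Units.val_mul, hσ]
    simp only [lower, fromBlocks_multiply]
    simp [Matrix.mul_assoc, hvu, sub_eq_add_neg, add_comm]
  rw [fromBlocks_inj] at hval
  obtain ⟨rfl, hb', rfl, hd'⟩ := hval
  subst b'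
  have hd : d' = vᴴ := by
    simp only [conjTranspose_zero, Matrix.zero_mul, smul_zero, add_zero] at k3
    rw [← Matrix.one_mul d', ← hvs, Matrix.mul_assoc, k3, Matrix.mul_one]
  have hβ : F.bar.IsHerm (v * b) := by
    have h5 := k2.bar
    rwa [hd, ← conjTranspose_mul, conjTranspose_conjTranspose] at h5
  have hfac : σ = F.lower (c * v) hγ * F.hyp u * F.upper (v * b) hβ := by
    refine F.GQ_ext ?_
    have h6 : d = vᴴ + c * v * b := by rw [← hd, hd']; abel
    simp only [Subgroup.coe_mul, Units.val_mul, hσ, lower, upper, hyp, fromBlocks_multiply, ← hv]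
    simp only [Matrix.mul_assoc, hvu, h6, Matrix.one_mul, Matrix.mul_one, Matrix.zero_mul,
      Matrix.mul_zero, add_zero, zero_add]
    rw [← Matrix.mul_assoc (u : Matrix ι ι R), huv, Matrix.one_mul, add_comm]
  rw [hfac, map_mul, map_mul, F.clsHom_eq_one_of_mem (F.lower_mem _ _),
    F.clsHom_eq_one_of_mem (F.upper_mem _ _), one_mul, mul_one, hypCls_apply]

end Class

/-! ### Functoriality of the classes, and constant polynomials -/

section Functoriality

variable {R S : Type*} [Ring R] [StarRing R] [Ring S] [StarRing S]
variable {F : FormRing R} {G : FormRing S} (f : Hom F G)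
variable {ι : Type*} [Fintype ι] [DecidableEq ι]

theorem Hom.mapK1_clsHom (σ : F.GQ ι) :
    f.mapK1 (F.clsHom ι σ) = G.clsHom ι (f.mapGQ ι σ) := by
  rw [clsHom_eq _ (Fintype.equivFin ι).toEmbedding, clsHom_eq _ (Fintype.equivFin ι).toEmbedding,
    ← f.mapGQ_stab]
  rfl

theorem Hom.mapK1_hypCls (u : (Matrix ι ι R)ˣ) :
    f.mapK1 (F.hypCls ι u) =
      G.hypCls ι (Units.map (f.toRingHom.mapMatrix (m := ι)).toMonoidHom u) := by
  rw [hypCls_apply, f.mapK1_clsHom, hypCls_apply]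
  congr 1
  refine G.GQ_ext ?_
  rw [f.mapGQ_val]
  simp only [hyp, fromBlocks_map, f.conjTranspose_map, ← map_inv]
  simp

/-- The homomorphism of form rings given by the constant polynomials. -/
noncomputable def constHom (F : FormRing R) : Hom F F.poly where
  toRingHom := C
  map_star x := by
    ext n
    rw [coeff_star_poly, coeff_C, coeff_C]
    split_ifs <;> simp
  map_lam := rfl
  map_param a ha n := by
    rw [coeff_C]
    split_ifs
    · exact ha
    · exact F.param.zero_mem

end Functoriality

/-! ### Schur complements and the Sylvester identity for hyperbolic classes -/

section Sylvester

variable {R : Type*} [Ring R] {ι κ : Type*} [Fintype ι] [DecidableEq ι] [Fintype κ] [DecidableEq κ]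

theorem exists_elementary_upper (b : Matrix ι κ R) :
    ∃ u ∈ elementaryGroup R (ι ⊕ κ), (u : Matrix (ι ⊕ κ) (ι ⊕ κ) R) = fromBlocks 1 b 0 1 := by
  obtain ⟨u, hu, hu'⟩ := mem_elementaryGroup_of_triangular
    (Sum.elim (fun _ : ι => 1) fun _ : κ => 0) (fromBlocks 0 b 0 0) (by
      rintro (x | x) (y | y) <;> simp)
  refine ⟨u, hu, ?_⟩
  rw [hu', ← fromBlocks_one, fromBlocks_add]
  simp

theorem exists_elementary_lower (c : Matrix κ ι R) :
    ∃ u ∈ elementaryGroup R (ι ⊕ κ), (u : Matrix (ι ⊕ κ) (ι ⊕ κ) R) = fromBlocks 1 0 c 1 := by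
  obtain ⟨u, hu, hu'⟩ := mem_elementaryGroup_of_triangular
    (Sum.elim (fun _ : ι => 0) fun _ : κ => 1) (fromBlocks 0 0 c 0) (by
      rintro (x | x) (y | y) <;> simp)
  refine ⟨u, hu, ?_⟩
  rw [hu', ← fromBlocks_one, fromBlocks_add]
  simp

variable [StarRing R] (F : FormRing R)

theorem matExt_sum_inl (M : Matrix ι ι R) :
    matExt (Function.Embedding.inl : ι ↪ ι ⊕ κ) M = fromBlocks M 0 0 1 := by
  rw [matExt_apply]
  ext (i | i) (j | j) <;> simp [inclMatrix, mul_apply, one_apply, apply_ite star]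

theorem matExt_sum_inr (M : Matrix κ κ R) :
    matExt (Function.Embedding.inr : κ ↪ ι ⊕ κ) M = fromBlocks 1 0 0 M := by
  rw [matExt_apply]
  ext (i | i) (j | j) <;> simp [inclMatrix, mul_apply, one_apply, apply_ite star]

/-- `(a b; c 1) = (1 b; 0 1)(a - bc 0; 0 1)(1 0; c 1)`, with elementary outer factors. -/
theorem hypCls_schur (a : Matrix ι ι R) (b : Matrix ι κ R) (c : Matrix κ ι R)
    (u : (Matrix ι ι R)ˣ) (hu : (u : Matrix ι ι R) = a - b * c) :
    ∃ v : (Matrix (ι ⊕ κ) (ι ⊕ κ) R)ˣ, (v : Matrix (ι ⊕ κ) (ι ⊕ κ) R) = fromBlocks a b c 1 ∧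
      F.hypCls _ v = F.hypCls _ u := by
  obtain ⟨x, hx, hx'⟩ := exists_elementary_upper b
  obtain ⟨y, hy, hy'⟩ := exists_elementary_lower c
  refine ⟨x * Units.map (matExt Function.Embedding.inl) u * y, ?_, ?_⟩
  · rw [Units.val_mul, Units.val_mul, hx', hy', Units.coe_map, matExt_sum_inl, hu]
    simp [fromBlocks_multiply]
  · rw [map_mul, map_mul, F.hypCls_eq_one_of_mem hx, F.hypCls_eq_one_of_mem hy, hypCls_matExt,
      one_mul, mul_one]

/-- The matrix `(1 U; V 1)` can be reduced through either diagonal block; the two Schur complements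
are `1 - UV` and `1 - VU`. -/
theorem hypCls_one_sub_mul (U : Matrix ι κ R) (V : Matrix κ ι R) (u : (Matrix ι ι R)ˣ)
    (hu : (u : Matrix ι ι R) = 1 - U * V) :
    ∃ v : (Matrix κ κ R)ˣ, (v : Matrix κ κ R) = 1 - V * U ∧ F.hypCls _ v = F.hypCls _ u := by
  obtain ⟨w, hw, hw'⟩ := F.hypCls_schur 1 U V u hu
  have h1 : (1 - U * V) * ((u⁻¹ : (Matrix ι ι R)ˣ) : Matrix ι ι R) = 1 := by
    rw [← hu, Units.mul_inv]
  have h2 : ((u⁻¹ : (Matrix ι ι R)ˣ) : Matrix ι ι R) * (1 - U * V) = 1 := by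
    rw [← hu, Units.inv_mul]
  generalize ((u⁻¹ : (Matrix ι ι R)ˣ) : Matrix ι ι R) = z at h1 h2
  rw [Matrix.sub_mul, Matrix.one_mul, sub_eq_iff_eq_add] at h1
  rw [Matrix.mul_sub, Matrix.mul_one, sub_eq_iff_eq_add] at h2
  -- If `z` inverts `1 - UV`, then `1 + V z U` inverts `1 - VU`.
  let v : (Matrix κ κ R)ˣ :=
    { val := 1 - V * U
      inv := 1 + V * z * U
      val_inv := by
        have : V * U * (V * z * U) = V * (U * V * z) * U := by simp only [Matrix.mul_assoc]
        rw [mul_add, mul_one, sub_mul 1, one_mul, this]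
        conv_lhs => enter [2, 1]; rw [h1]
        rw [Matrix.mul_add, Matrix.add_mul, Matrix.mul_one]
        abel
      inv_val := by
        have : V * z * U * (V * U) = V * (z * (U * V)) * U := by simp only [Matrix.mul_assoc]
        rw [add_mul, one_mul, mul_sub _ 1, mul_one, this]
        conv_lhs => enter [2, 1]; rw [h2]
        rw [Matrix.mul_add, Matrix.add_mul, Matrix.mul_one]
        abel }
  refine ⟨v, rfl, ?_⟩
  obtain ⟨x, hx, hx'⟩ := exists_elementary_upper U
  obtain ⟨y, hy, hy'⟩ := exists_elementary_lower V
  have h3 : w = y * Units.map (matExt Function.Embedding.inr) v * x := by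
    refine Units.ext ?_
    rw [Units.val_mul, Units.val_mul, hx', hy', Units.coe_map, matExt_sum_inr, hw]
    simp [fromBlocks_multiply, v]
  rw [← hw', h3, map_mul, map_mul, F.hypCls_eq_one_of_mem hx, F.hypCls_eq_one_of_mem hy,
    hypCls_matExt, one_mul, mul_one]

end Sylvester

/-! ### Nilpotency from polynomial invertibility -/

section Nilpotent

variable {R : Type*} [Ring R]

/-- The inverse of `1 - XN` must be the geometric series with coefficients `N^n`; being polynomial,
it has only finitely many nonzero coefficients. -/
theorem isNilpotent_of_isUnit_one_sub_X_smul {ι : Type*} [Fintype ι] [DecidableEq ι]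
    (N : Matrix ι ι R) (u : (Matrix ι ι R[X])ˣ)
    (hu : (u : Matrix ι ι R[X]) = 1 - (X : R[X]) • N.map C) : IsNilpotent N := by
  have h1 := u.mul_inv
  rw [hu] at h1
  generalize ((u⁻¹ : (Matrix ι ι R[X])ˣ) : Matrix ι ι R[X]) = W at h1
  have h2 : W = 1 + (X : R[X]) • (N.map C * W) := by
    rw [sub_mul, one_mul, smul_mul, sub_eq_iff_eq_add] at h1
    exact h1
  have h3 : ∀ n, (W.map fun p => p.coeff n) = N ^ n := by
    intro n
    induction n with
    | zero =>
      ext i j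
      rw [map_apply, h2]
      simp [one_apply, apply_ite (fun p : R[X] => p.coeff 0)]
    | succ n ih =>
      rw [pow_succ', ← ih]
      ext i j
      rw [map_apply]
      conv_lhs => rw [h2]
      simp only [Matrix.add_apply, Matrix.smul_apply, smul_eq_mul, coeff_add, coeff_X_mul,
        mul_apply, finsetSum_coeff, map_apply, coeff_C_mul]
      rw [one_apply]
      split_ifs <;> simp [coeff_one]
  refine ⟨Finset.univ.sup (fun z : ι × ι => (W z.1 z.2).natDegree) + 1, ?_⟩
  rw [← h3]
  ext i j
  exact coeff_eq_zero_of_natDegree_lt (Nat.lt_succ_of_le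
    (Finset.le_sup (f := fun z : ι × ι => (W z.1 z.2).natDegree) (Finset.mem_univ (i, j))))

end Nilpotent

/-! ### Higman linearization -/

section Linearization

variable {R : Type*} [Ring R] [StarRing R] (F : FormRing R)

/-- A top-degree term `c X^(d+2)` is split as `(c X^(d+1)) · X`. This presents the matrix as the
Schur complement of one of twice the size with entries of degree at most `d + 1`, in the same class;
iteration stops at degree one. -/
theorem exists_linear_of_natDegree_le (d : ℕ) :
    ∀ (ι : Type) [Fintype ι] [DecidableEq ι] (u : (Matrix ι ι R[X])ˣ),
      (∀ i j, ((u : Matrix ι ι R[X]) i j).natDegree ≤ d + 1) →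
      ∃ (κ : Type) (_ : Fintype κ) (_ : DecidableEq κ) (A B : Matrix κ κ R)
        (v : (Matrix κ κ R[X])ˣ), (v : Matrix κ κ R[X]) = A.map C + (X : R[X]) • B.map C ∧
        F.poly.hypCls κ v = F.poly.hypCls ι u := by
  induction d with
  | zero =>
    intro ι _ _ u hu
    refine ⟨ι, _, _, (u : Matrix ι ι R[X]).map fun p => p.coeff 0,
      (u : Matrix ι ι R[X]).map fun p => p.coeff 1, u, ?_, rfl⟩
    ext1 i j
    conv_lhs => rw [eq_X_add_C_of_natDegree_le_one (hu i j)]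
    simp [X_mul_C, add_comm]
  | succ d ih =>
    intro ι _ _ u hu
    let p : Matrix ι ι R[X] := u
    obtain ⟨v, hv, hv'⟩ := F.poly.hypCls_schur
      (Matrix.of fun i j => p i j - C ((p i j).coeff (d + 2)) * X ^ (d + 2))
      (Matrix.of fun i j => -(C ((p i j).coeff (d + 2)) * X ^ (d + 1)))
      (diagonal fun _ => (X : R[X])) u (by
        ext1 i j
        simp [mul_diagonal, p, mul_assoc, ← pow_succ])
    rw [← hv']
    refine ih (ι ⊕ ι) v ?_
    rw [hv]
    have hX : ∀ e, ((X : R[X]) ^ e).natDegree ≤ e := natDegree_X_pow_le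
    rintro (i | i) (j | j)
    · rw [natDegree_le_iff_coeff_eq_zero]
      intro N hN
      change (p i j - C ((p i j).coeff (d + 2)) * X ^ (d + 2)).coeff N = 0
      rw [coeff_sub, coeff_C_mul, coeff_X_pow]
      split_ifs with h
      · rw [h]; simp
      · rw [coeff_eq_zero_of_natDegree_lt ((hu i j).trans_lt (by omega))]
        simp
    · change (-(C ((p i j).coeff (d + 2)) * X ^ (d + 1))).natDegree ≤ _
      rw [natDegree_neg]
      exact natDegree_C_mul_X_pow_le _ _
    · change ((diagonal fun _ => (X : R[X])) i j).natDegree ≤ _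
      rw [diagonal_apply]
      split_ifs
      · exact natDegree_X_le.trans (by omega)
      · simp
    · change ((1 : Matrix ι ι R[X]) i j).natDegree ≤ _
      rw [one_apply]
      split_ifs <;> simp

/-- Higman's trick: a class of `NK₁GQ` which comes from the general linear group is represented by
`H(1 - XN)` with `N` nilpotent. -/
theorem exists_nilpotent_of_mem_NK1GQ {ι : Type} [Fintype ι] [DecidableEq ι]
    (u : (Matrix ι ι R[X])ˣ) (hu : F.poly.hypCls ι u ∈ F.NK1GQ) :
    ∃ (κ : Type) (_ : Fintype κ) (_ : DecidableEq κ) (N : Matrix κ κ R)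
      (v : (Matrix κ κ R[X])ˣ), IsNilpotent N ∧
      (v : Matrix κ κ R[X]) = 1 - (X : R[X]) • N.map C ∧
      F.poly.hypCls κ v = F.poly.hypCls ι u := by
  obtain ⟨κ, _, _, A, B, v, hv, hvu⟩ := F.exists_linear_of_natDegree_le
    (Finset.univ.sup fun z : ι × ι => ((u : Matrix ι ι R[X]) z.1 z.2).natDegree) ι u
    fun i j => (Finset.le_sup (f := fun z : ι × ι => ((u : Matrix ι ι R[X]) z.1 z.2).natDegree)
      (Finset.mem_univ (i, j))).trans (Nat.le_succ _)
  -- The constant term `A₀` is the value at `X = 0`, so its class is trivial by the kernel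
  -- condition, and stays trivial over `R[X]`. Dividing by it normalizes the constant term to `1`.
  let A₀ : (Matrix κ κ R)ˣ := Units.map (F.evalZero.toRingHom.mapMatrix (m := κ)).toMonoidHom v
  have hA₀ : (A₀ : Matrix κ κ R) = A := by
    change (v : Matrix κ κ R[X]).map (constantCoeff : R[X] →+* R) = A
    rw [hv]
    ext i j
    simp
  have h1 : F.hypCls κ A₀ = 1 := by
    rw [← F.evalZero.mapK1_hypCls, hvu]
    exact hu
  let A₁ : (Matrix κ κ R[X])ˣ := Units.map (F.constHom.toRingHom.mapMatrix (m := κ)).toMonoidHom A₀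
  have hA₁ : (A₁ : Matrix κ κ R[X]) = A.map C := by rw [← hA₀]; rfl
  have h2 : F.poly.hypCls κ A₁ = 1 := by
    rw [← F.constHom.mapK1_hypCls, h1, map_one]
  let N : Matrix κ κ R := -(((A₀⁻¹ : (Matrix κ κ R)ˣ) : Matrix κ κ R) * B)
  have hinv : ((A₁⁻¹ : (Matrix κ κ R[X])ˣ) : Matrix κ κ R[X]) =
      ((A₀⁻¹ : (Matrix κ κ R)ˣ) : Matrix κ κ R).map C := rfl
  have h3 : ((A₁⁻¹ * v : (Matrix κ κ R[X])ˣ) : Matrix κ κ R[X]) =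
      1 - (X : R[X]) • N.map C := by
    have h4 : N.map (C : R →+* R[X]) = -(((A₁⁻¹ : (Matrix κ κ R[X])ˣ) : Matrix κ κ R[X]) *
        B.map C) := by
      rw [hinv]
      ext1 i j
      simp [N, mul_apply]
    have h5 : ∀ M M' : Matrix κ κ R[X], M * ((X : R[X]) • M') = (X : R[X]) • (M * M') := by
      intro M M'
      ext1 i j
      simp only [mul_apply, Matrix.smul_apply, smul_eq_mul, Finset.mul_sum]
      exact Finset.sum_congr rfl fun x _ => by rw [← mul_assoc, ← X_mul, mul_assoc]
    rw [Units.val_mul, hv, ← hA₁, mul_add, Units.inv_mul, h5, h4, smul_neg, sub_neg_eq_add]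
  refine ⟨κ, _, _, N, A₁⁻¹ * v, isNilpotent_of_isUnit_one_sub_X_smul N _ h3, h3, ?_⟩
  rw [map_mul, map_inv, h2, inv_one, one_mul, hvu]

end Linearization

/-! ### Transfer of quadratic groups along a matrix representation -/

section Transfer

variable {R S : Type*} [Ring R] [StarRing R] [Ring S] [StarRing S]

/-- Data for a transfer of quadratic groups along a matrix representation `ρ` of `R` over `S`
which is compatible with the symmetric form `J`. -/
structure Transfer (F : FormRing R) (G : FormRing S) (m : Type*) [Fintype m] [DecidableEq m] where
  toRingHom : R →+* Matrix m m S
  form : Matrix m m S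
  form_star : formᴴ = form
  form_mul_form : form * form = 1
  map_star : ∀ x, toRingHom (star x) = form * (toRingHom x)ᴴ * form
  map_lam : toRingHom F.lam = G.lam • 1
  map_param : ∀ a ∈ F.param, ∀ p, (form * toRingHom a) p p ∈ G.param

namespace Transfer

variable {F : FormRing R} {G : FormRing S} {m : Type*} [Fintype m] [DecidableEq m]
variable (T : Transfer F G m)
variable {ι κ μ : Type*} [Fintype ι] [DecidableEq ι] [Fintype κ] [DecidableEq κ]

/-- The transfer between the opposite form rings. -/
def bar : Transfer F.bar G.bar m where
  toRingHom := T.toRingHom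
  form := T.form
  form_star := T.form_star
  form_mul_form := T.form_mul_form
  map_star := T.map_star
  map_lam := by
    change T.toRingHom (star F.lam) = star G.lam • 1
    rw [T.map_star, T.map_lam, G.conjTranspose_lam_smul, conjTranspose_one]
    have := G.bar.mul_lam_smul T.form (1 : Matrix m m S)
    change T.form * (star G.lam • 1) = star G.lam • (T.form * 1) at this
    rw [this, mul_one, Matrix.smul_mul, T.form_mul_form]
  map_param a ha p := by
    change star _ ∈ G.param
    have h := T.map_param _ ha p
    rwa [T.map_star, ← mul_assoc, ← mul_assoc, T.form_mul_form, one_mul, ← T.form_star,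
      ← conjTranspose_mul] at h

/-- Applying the representation to all entries of a matrix. -/
def expand (M : Matrix ι μ R) : Matrix (ι × m) (μ × m) S :=
  Matrix.of fun x y => T.toRingHom (M x.1 y.1) x.2 y.2

theorem expand_add (M N : Matrix ι μ R) : T.expand (M + N) = T.expand M + T.expand N := by
  ext x y
  simp [expand]

theorem expand_mul (M : Matrix κ ι R) (N : Matrix ι μ R) :
    T.expand (M * N) = T.expand M * T.expand N := by
  ext x y
  simp only [expand, of_apply, mul_apply, map_sum, map_mul, Matrix.sum_apply,
    Fintype.sum_prod_type]

theorem expand_zero : T.expand (0 : Matrix ι μ R) = 0 := by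
  ext x y
  simp [expand]

theorem expand_one : T.expand (1 : Matrix ι ι R) = 1 := by
  ext ⟨i, p⟩ ⟨j, q⟩
  by_cases h : i = j
  · subst h
    simp [expand, one_apply]
  · simp [expand, one_apply, h]

/-- The form on the expanded module. -/
def bigForm (ι : Type*) [DecidableEq ι] : Matrix (ι × m) (ι × m) S :=
  Matrix.of fun x y => if x.1 = y.1 then T.form x.2 y.2 else 0

theorem bigForm_mul (M : Matrix (ι × m) μ S) (x : ι × m) (y : μ) :
    (T.bigForm ι * M) x y = ∑ p, T.form x.2 p * M (x.1, p) y := by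
  simp [mul_apply, bigForm, Fintype.sum_prod_type, ite_mul, Finset.sum_ite_irrel]

theorem mul_bigForm (M : Matrix μ (ι × m) S) (x : μ) (y : ι × m) :
    (M * T.bigForm ι) x y = ∑ p, M x (y.1, p) * T.form p y.2 := by
  simp [mul_apply, bigForm, Fintype.sum_prod_type, Finset.sum_ite_irrel]

theorem bigForm_mul_bigForm : T.bigForm ι * T.bigForm ι = 1 := by
  ext ⟨i, p⟩ ⟨j, q⟩
  rw [bigForm_mul]
  by_cases h : i = j
  · subst h
    have := congrFun (congrFun T.form_mul_form p) q
    rw [mul_apply] at this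
    simpa [bigForm, one_apply] using this
  · simp [bigForm, h, one_apply]

theorem conjTranspose_bigForm : (T.bigForm ι)ᴴ = T.bigForm ι := by
  ext ⟨i, p⟩ ⟨j, q⟩
  have := congrFun (congrFun T.form_star p) q
  rw [conjTranspose_apply] at this
  by_cases h : i = j
  · subst h
    simpa [bigForm] using this
  · simp [bigForm, h, Ne.symm h]

theorem expand_conjTranspose (M : Matrix ι κ R) :
    T.expand Mᴴ = T.bigForm κ * (T.expand M)ᴴ * T.bigForm ι := by
  ext x y
  rw [mul_bigForm]
  simp only [bigForm_mul]
  simp only [expand, of_apply, conjTranspose_apply, T.map_star]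
  rw [mul_apply]
  simp only [mul_apply, conjTranspose_apply]

theorem expand_lam_smul (M : Matrix ι κ R) : T.expand (F.lam • M) = G.lam • T.expand M := by
  ext x y
  simp [expand, T.map_lam]

/-- The representation respects `*` only up to conjugation by the form; left multiplication by the
form removes the twist, and `map_param` is exactly the resulting condition on the diagonal. -/
theorem isHerm_expand {M : Matrix ι ι R} (hM : F.IsHerm M) :
    G.IsHerm (T.bigForm ι * T.expand M) := by
  refine ⟨?_, fun x => ?_⟩
  · rw [conjTranspose_mul, conjTranspose_bigForm]
    have h : (T.expand M)ᴴ * T.bigForm ι = T.bigForm ι * T.expand Mᴴ := by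
      rw [expand_conjTranspose, ← Matrix.mul_assoc, ← Matrix.mul_assoc, bigForm_mul_bigForm,
        Matrix.one_mul]
    have h2 : T.expand M + G.lam • T.expand Mᴴ = 0 := by
      rw [← expand_lam_smul, ← expand_add, ← T.expand_zero]
      congr 1
      rw [← eq_neg_iff_add_eq_zero]
      exact hM.1
    rw [h, ← G.mul_lam_smul, ← Matrix.mul_neg, ← eq_neg_of_add_eq_zero_left h2]
  · have := T.map_param _ (hM.2 x.1) x.2
    rw [bigForm_mul]
    rwa [mul_apply] at this

/-- The transfer of a matrix of the hyperbolic module. -/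
def hypExpand (M : Matrix (ι ⊕ ι) (ι ⊕ ι) R) : Matrix (ι × m ⊕ ι × m) (ι × m ⊕ ι × m) S :=
  fromBlocks (T.expand M.toBlocks₁₁) (T.expand M.toBlocks₁₂ * T.bigForm ι)
    (T.bigForm ι * T.expand M.toBlocks₂₁) (T.bigForm ι * T.expand M.toBlocks₂₂ * T.bigForm ι)

theorem hypExpand_fromBlocks (a b c d : Matrix ι ι R) :
    T.hypExpand (fromBlocks a b c d) = fromBlocks (T.expand a) (T.expand b * T.bigForm ι)
      (T.bigForm ι * T.expand c) (T.bigForm ι * T.expand d * T.bigForm ι) := rfl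

/-- `hypExpand` is entrywise expansion conjugated by `diag(1, J)`, with `J` the big form and `J² =
1`. This change of basis turns the twisted hyperbolic form into the standard one. -/
theorem hypExpand_mul (M N : Matrix (ι ⊕ ι) (ι ⊕ ι) R) :
    T.hypExpand (M * N) = T.hypExpand M * T.hypExpand N := by
  rw [← fromBlocks_toBlocks M, ← fromBlocks_toBlocks N, fromBlocks_multiply]
  simp only [hypExpand_fromBlocks, fromBlocks_multiply, expand_add, expand_mul]
  have h : ∀ x : Matrix (ι × m) (ι × m) S, T.bigForm ι * (T.bigForm ι * x) = x := fun x => by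
    rw [← Matrix.mul_assoc, bigForm_mul_bigForm, Matrix.one_mul]
  simp only [Matrix.mul_add, Matrix.add_mul, Matrix.mul_assoc, h]

theorem hypExpand_one : T.hypExpand (1 : Matrix (ι ⊕ ι) (ι ⊕ ι) R) = 1 := by
  rw [← fromBlocks_one, hypExpand_fromBlocks]
  simp [expand_one, expand_zero, bigForm_mul_bigForm]

/-- `expand` as a monoid homomorphism. -/
def expandHom (ι : Type*) [Fintype ι] [DecidableEq ι] :
    Matrix ι ι R →* Matrix (ι × m) (ι × m) S where
  toFun := T.expand
  map_one' := T.expand_one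
  map_mul' := T.expand_mul

theorem hypExpand_hyp (u : (Matrix ι ι R)ˣ) :
    T.hypExpand ((F.hyp u).1 : Matrix (ι ⊕ ι) (ι ⊕ ι) R) =
      ((G.hyp (Units.map (T.expandHom ι) u)).1 : Matrix _ _ S) := by
  have h : T.bigForm ι * T.expand ((u⁻¹ : (Matrix ι ι R)ˣ) : Matrix ι ι R)ᴴ * T.bigForm ι =
      (T.expand ((u⁻¹ : (Matrix ι ι R)ˣ) : Matrix ι ι R))ᴴ := by
    rw [expand_conjTranspose, ← Matrix.mul_assoc, ← Matrix.mul_assoc, bigForm_mul_bigForm,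
      Matrix.one_mul, Matrix.mul_assoc, bigForm_mul_bigForm, Matrix.mul_one]
  simp only [hyp, hypExpand_fromBlocks, h, expand_zero, ← map_inv]
  simp [expandHom]

theorem expand_mem_elementaryGroup {u : (Matrix ι ι R)ˣ} (hu : u ∈ elementaryGroup R ι) :
    Units.map (T.expandHom ι) u ∈ elementaryGroup S (ι × m) := by
  have h : elementaryGroup R ι ≤
      (elementaryGroup S (ι × m)).comap (Units.map (T.expandHom ι)) := by
    refine (Subgroup.closure_le _).2 ?_
    rintro v ⟨i, j, a, hij, hv⟩
    -- A transvection expands to a single off-diagonal block in block row `i` and block column `j ≠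
    -- i`.
    refine mem_elementaryGroup_of_block (fun x => x.1 = i) (T.expand (single i j a)) ?_ _ ?_
    · rintro ⟨k, p⟩ ⟨l, q⟩ h0
      by_cases hk : i = k
      · by_cases hl : j = l
        · exact ⟨hk.symm, fun h => hij (h.symm.trans hl.symm)⟩
        · simp [expand, hl] at h0
      · simp [expand, hk] at h0
    · rw [Units.coe_map, hv]
      change T.expand _ = _
      rw [expand_add, expand_one]
  exact h hu

theorem exists_mem_EQ {σ : F.GQ ι} (hσ : σ ∈ F.EQ ι) :
    ∃ τ ∈ G.EQ (ι × m), (τ.1 : Matrix (ι × m ⊕ ι × m) (ι × m ⊕ ι × m) S) = T.hypExpand σ.1 := by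
  induction hσ using Subgroup.closure_induction with
  | mem x hx =>
    rcases hx with (⟨ε, hε, rfl⟩ | ⟨β, hβ, rfl⟩) | ⟨γ, hγ, rfl⟩
    · exact ⟨_, G.hyp_mem (T.expand_mem_elementaryGroup hε), (T.hypExpand_hyp ε).symm⟩
    -- The opposite transfer puts the form on the left of `expand β`; conjugating by the form moves
    -- it to the right, as the upper right block requires.
    · have h : G.bar.IsHerm (T.expand β * T.bigForm ι) := by
        have h1 := (T.bar.isHerm_expand hβ).conj (T.bigForm ι)
        change G.bar.IsHerm ((T.bigForm ι)ᴴ * (T.bigForm ι * T.expand β) * T.bigForm ι) at h1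
        rwa [conjTranspose_bigForm, ← Matrix.mul_assoc, bigForm_mul_bigForm,
          Matrix.one_mul] at h1
      refine ⟨_, G.upper_mem _ h, ?_⟩
      simp [upper, hypExpand_fromBlocks, expand_one, expand_zero, bigForm_mul_bigForm]
    · refine ⟨_, G.lower_mem _ (T.isHerm_expand hγ), ?_⟩
      simp [lower, hypExpand_fromBlocks, expand_one, expand_zero, bigForm_mul_bigForm]
  | one => exact ⟨1, one_mem _, T.hypExpand_one.symm⟩
  | mul x y _ _ hx hy =>
    obtain ⟨τ, hτ, h1⟩ := hx
    obtain ⟨τ', hτ', h2⟩ := hy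
    exact ⟨τ * τ', mul_mem hτ hτ', by
      rw [Subgroup.coe_mul, Subgroup.coe_mul, Units.val_mul, Units.val_mul, h1, h2,
        hypExpand_mul]⟩
  | inv x _ hx =>
    obtain ⟨τ, hτ, h1⟩ := hx
    refine ⟨τ⁻¹, inv_mem hτ, ?_⟩
    rw [Subgroup.coe_inv, Units.inv_eq_of_mul_eq_one_right]
    rw [h1, ← hypExpand_mul, Subgroup.coe_inv, Units.mul_inv, hypExpand_one]

/-- Triviality is witnessed by membership in a finite elementary group, which `exists_mem_EQ`
transfers; expansion commutes with stabilization. -/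
theorem hypCls_expand_eq_one {u : (Matrix ι ι R)ˣ} (hu : F.hypCls ι u = 1) :
    G.hypCls (ι × m) (Units.map (T.expandHom ι) u) = 1 := by
  obtain ⟨n, e, he⟩ := F.exists_stab_mem_EQ hu
  change F.stab e (F.hyp u) ∈ _ at he
  rw [stab_hyp] at he
  obtain ⟨τ, hτ, h1⟩ := T.exists_mem_EQ he
  rw [hypExpand_hyp] at h1
  rw [G.GQ_ext h1] at hτ
  let e' : ι × m ↪ Fin n × m := e.prodMap (Function.Embedding.refl m)
  have h2 := G.clsHom_eq_one_of_mem hτ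
  rw [← hypCls_apply] at h2
  rw [← G.hypCls_matExt e', ← h2]
  congr 1
  refine Units.ext ?_
  have h3 : T.expand (inclMatrix R e) = inclMatrix S e' := by
    ext ⟨i, p⟩ ⟨j, q⟩
    by_cases h : i = e j <;> simp [expand, inclMatrix, h, e', one_apply]
  have h4 : T.expand (inclMatrix R e)ᴴ = (inclMatrix S e')ᴴ := by
    ext ⟨i, p⟩ ⟨j, q⟩
    by_cases h : j = e i <;> simp [expand, inclMatrix, h, e', one_apply, eq_comm, apply_ite star]
  have h5 : T.expand ((u : Matrix ι ι R) - 1) = T.expand (u : Matrix ι ι R) - 1 := by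
    rw [eq_sub_iff_add_eq, ← T.expand_one, ← expand_add, sub_add_cancel]
  change matExt e' (T.expand (u : Matrix ι ι R)) = T.expand (matExt e (u : Matrix ι ι R))
  rw [matExt_apply, matExt_apply, expand_add, expand_mul, expand_mul, h3, h4, h5, expand_one]

end Transfer

end Transfer

/-! ### Scalars, and transfers substituting a matrix for `X` -/

section Scalars

variable {R : Type*} [Ring R] [StarRing R] (F : FormRing R)

/-- The commutative ring of self-adjoint central elements which preserve the form parameter. -/
def scalars : Subring R where
  carrier := {a | (∀ x, a * x = x * a) ∧ star a = a ∧ ∀ c ∈ F.param, a * c ∈ F.param}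
  mul_mem' := fun {a _} ha hb => ⟨fun x => by rw [mul_assoc, hb.1, ← mul_assoc, ha.1, mul_assoc],
    by rw [star_mul, ha.2.1, hb.2.1, ha.1],
    fun c hc => by rw [mul_assoc]; exact ha.2.2 _ (hb.2.2 _ hc)⟩
  one_mem' := ⟨by simp, by simp, by simp⟩
  add_mem' := fun ha hb => ⟨fun x => by rw [add_mul, mul_add, ha.1, hb.1],
    by rw [star_add, ha.2.1, hb.2.1],
    fun c hc => by rw [add_mul]; exact F.param.add_mem (ha.2.2 _ hc) (hb.2.2 _ hc)⟩
  zero_mem' := ⟨by simp, by simp, by simp⟩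
  neg_mem' := fun {a} ha => ⟨fun x => by rw [neg_mul, mul_neg, ha.1],
    by rw [star_neg, ha.2.1],
    fun c hc => by rw [neg_mul]; exact F.param.neg_mem (ha.2.2 _ hc)⟩

instance scalarsCommRing : CommRing F.scalars :=
  { (inferInstance : Ring F.scalars) with
    mul_comm := fun a _ => Subtype.ext (a.2.1 _) }

theorem C_mem_scalars {a : R} (ha : a ∈ F.scalars) : C a ∈ F.poly.scalars := by
  refine ⟨fun p => ?_, ?_, fun p hp n => ?_⟩
  · ext n
    rw [coeff_C_mul, coeff_mul_C, ha.1]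
  · exact (F.constHom.map_star a).symm.trans (congrArg C ha.2.1)
  · rw [coeff_C_mul]
    exact ha.2.2 _ (hp n)

theorem X_mem_scalars : (X : R[X]) ∈ F.poly.scalars := by
  refine ⟨fun p => X_mul, ?_, fun p hp n => ?_⟩
  · ext n
    rw [coeff_star_poly, coeff_X]
    split_ifs <;> simp
  · cases n with
    | zero => simp
    | succ n =>
      rw [coeff_X_mul]
      exact hp n

variable {m : Type*} [Fintype m] [DecidableEq m]

theorem commute_of_mem_scalars {S : Matrix m m R} (hS : ∀ p q, S p q ∈ F.scalars)
    (x : R) : Commute (scalar m x) S := by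
  ext p q
  simp [(hS p q).1]

/-- The transfer `R[X] → R[X]` which sends `X` to a matrix `S` of scalars, symmetric with respect
to the form `J`. -/
noncomputable def polyTransfer (S J : Matrix m m R[X]) (hS : ∀ p q, S p q ∈ F.poly.scalars)
    (hJ : ∀ p q, J p q ∈ F.poly.scalars) (hJs : Jᴴ = J) (hJJ : J * J = 1)
    (hJS : J * Sᴴ * J = S) : Transfer F.poly F.poly m where
  toRingHom := eval₂RingHom' ((scalar m).comp C) S
    fun a => F.poly.commute_of_mem_scalars hS (C a)
  form := J
  form_star := hJs
  form_mul_form := hJJ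
  map_star p := by
    have hJc : ∀ M : Matrix m m R[X], J * (J * M) = M := fun M => by
      rw [← mul_assoc, hJJ, one_mul]
    have hpow : ∀ n : ℕ, J * (Sᴴ) ^ n * J = S ^ n := by
      intro n
      induction n with
      | zero => simp [hJJ]
      | succ n ih =>
        rw [pow_succ, pow_succ, ← ih]
        conv_rhs => enter [2]; rw [← hJS]
        simp only [mul_assoc, hJc]
    induction p using Polynomial.induction_on' with
    | add p q hp hq => rw [star_add, map_add, map_add, conjTranspose_add, hp, hq, mul_add, add_mul]
    | monomial n c =>
      have h1 : star (monomial n c) = monomial n (star c) := by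
        ext i
        rw [coeff_star_poly, coeff_monomial, coeff_monomial]
        split_ifs <;> simp
      have h2 : star (C c) = C (star c) := (F.constHom.map_star c).symm
      have h3 : (scalar m (C c))ᴴ = scalar m (C (star c)) := by
        ext1 p q
        rw [conjTranspose_apply, scalar_apply, scalar_apply, diagonal_apply, diagonal_apply]
        by_cases h : p = q
        · simp [h, h2]
        · simp [h, Ne.symm h]
      have h4 : Commute (scalar m (C (star c))) J := F.poly.commute_of_mem_scalars hJ _
      have h5 : Commute (scalar m (C (star c))) S := F.poly.commute_of_mem_scalars hS _
      rw [h1]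
      simp only [eval₂RingHom'_apply, eval₂_monomial, RingHom.comp_apply]
      rw [conjTranspose_mul, conjTranspose_pow, h3, (h5.pow_right n).eq, ← hpow]
      simp only [mul_assoc, h4.eq]
  map_lam := by
    change eval₂RingHom' ((scalar m).comp C) S _ (C F.lam) = C F.lam • 1
    rw [eval₂RingHom'_apply, eval₂_C]
    ext1 p q
    simp [diagonal_apply, one_apply]
  map_param a ha p := by
    -- Each diagonal entry of `J ρ(a)`, with `ρ` the substitution, is a sum of products of an entry
    -- of `J S^n`, which is a scalar, with the coefficient `a_n` in `Λ`.
    have hmem : ∀ n, J * S ^ n ∈ F.poly.scalars.matrix := fun n =>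
      mul_mem (show J ∈ F.poly.scalars.matrix from hJ)
        (pow_mem (show S ∈ F.poly.scalars.matrix from hS) n)
    rw [eval₂RingHom'_apply, eval₂_eq_sum, Polynomial.sum, Finset.mul_sum, Matrix.sum_apply]
    refine F.poly.param.sum_mem fun n _ => ?_
    have h4 : Commute (scalar m (C (a.coeff n))) J := F.poly.commute_of_mem_scalars hJ _
    have h5 : Commute (scalar m (C (a.coeff n))) (J * S ^ n) :=
      F.poly.commute_of_mem_scalars (fun p q => hmem n p q) _
    rw [RingHom.comp_apply, ← mul_assoc, ← h4.eq, mul_assoc, h5.eq, scalar_apply, mul_diagonal]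
    exact (hmem n p p).2.2 _ (F.constHom.map_param _ (ha n))

theorem polyTransfer_expand {S J : Matrix m m R[X]} (hS : ∀ p q, S p q ∈ F.poly.scalars)
    (hJ : ∀ p q, J p q ∈ F.poly.scalars) (hJs : Jᴴ = J) (hJJ : J * J = 1)
    (hJS : J * Sᴴ * J = S) {ι : Type*} [Fintype ι] [DecidableEq ι] (N : Matrix ι ι R) :
    (F.polyTransfer S J hS hJ hJs hJJ hJS).expand (1 - (X : R[X]) • N.map C) =
      1 - Matrix.of fun x y : ι × m => C (N x.1 y.1) * S x.2 y.2 := by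
  set T := F.polyTransfer S J hS hJ hJs hJJ hJS
  rw [eq_sub_iff_add_eq, ← T.expand_one]
  have h : (Matrix.of fun x y : ι × m => C (N x.1 y.1) * S x.2 y.2) =
      T.expand ((X : R[X]) • N.map C) := by
    ext1 x y
    change _ = (eval₂ ((scalar m).comp C) S (X * C (N x.1 y.1))) x.2 y.2
    rw [X_mul, C_mul_X_eq_monomial, eval₂_monomial]
    simp
  rw [h, ← T.expand_add, sub_add_cancel]

/-! ### The companion matrix of `X^(n+1) - w` -/

section Shift

variable (n : ℕ) (w : R)

/-- The companion matrix of `X ^ (n + 1) - w`. -/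
def shiftMatrix : Matrix (Fin (n + 1)) (Fin (n + 1)) R :=
  Matrix.of fun p q => (if p.val = q.val + 1 then 1 else 0) +
    if p.val = 0 ∧ q.val = n then w else 0

/-- The antidiagonal matrix. -/
def antidiag (R : Type*) [Ring R] (n : ℕ) : Matrix (Fin (n + 1)) (Fin (n + 1)) R :=
  (1 : Matrix (Fin (n + 1)) (Fin (n + 1)) R).submatrix Fin.rev id

theorem antidiag_mul (M : Matrix (Fin (n + 1)) (Fin (n + 1)) R) :
    antidiag R n * M = M.submatrix Fin.rev id := by
  have h := submatrix_mul (1 : Matrix (Fin (n + 1)) (Fin (n + 1)) R) M Fin.rev id id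
    Function.bijective_id
  rw [one_mul, submatrix_id_id] at h
  exact h.symm

theorem antidiag_mul_antidiag : antidiag R n * antidiag R n = 1 := by
  rw [antidiag_mul, antidiag, submatrix_submatrix]
  ext p q
  simp [one_apply]

theorem conjTranspose_antidiag : (antidiag R n)ᴴ = antidiag R n := by
  ext p q
  simp only [antidiag, conjTranspose_apply, submatrix_apply, one_apply, id]
  rw [apply_ite star, star_one, star_zero]
  refine if_congr ?_ rfl rfl
  rw [Fin.rev_eq_iff, eq_comm]

theorem mul_antidiag (M : Matrix (Fin (n + 1)) (Fin (n + 1)) R) :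
    M * antidiag R n = M.submatrix id Fin.rev := by
  have h := antidiag_mul n Mᴴ
  rw [← conjTranspose_antidiag, ← conjTranspose_mul] at h
  rw [← conjTranspose_conjTranspose (M * _), h]
  ext p q
  simp

/-- Transposing and reversing both indices is reflection in the antidiagonal, which preserves the
subdiagonal and fixes the corner `(0, n)`. -/
theorem antidiag_mul_shiftMatrix (hw : star w = w) :
    antidiag R n * (shiftMatrix n w)ᴴ * antidiag R n = shiftMatrix n w := by
  rw [mul_antidiag, antidiag_mul]
  ext p q
  simp only [shiftMatrix, submatrix_apply, conjTranspose_apply, of_apply, id, star_add,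
    apply_ite star, hw, star_one, star_zero, Fin.val_rev]
  congr 1
  · exact if_congr (by omega) rfl rfl
  · exact if_congr (by omega) rfl rfl

theorem shiftMatrix_mem_scalars (hw : w ∈ F.scalars) (p q : Fin (n + 1)) :
    shiftMatrix n w p q ∈ F.scalars := by
  rw [shiftMatrix, of_apply]
  refine add_mem ?_ ?_ <;> split_ifs <;> first | assumption | exact one_mem _ | exact zero_mem _

theorem antidiag_mem_scalars (p q : Fin (n + 1)) : antidiag R n p q ∈ F.scalars := by
  rw [antidiag, submatrix_apply, one_apply]
  split_ifs
  · exact one_mem _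
  · exact zero_mem _

/-- Elementary reduction of `1 - N ⊗ S` for the companion matrix `S` of `X ^ (n + 1) - w`. -/
theorem hypCls_one_sub_shift {ι : Type*} [Fintype ι] [DecidableEq ι] (N : Matrix ι ι R)
    (u : (Matrix (ι × Fin (n + 1)) (ι × Fin (n + 1)) R)ˣ)
    (hu : (u : Matrix _ _ R) =
      1 - Matrix.of fun x y : ι × Fin (n + 1) => N x.1 y.1 * shiftMatrix n w x.2 y.2)
    (hw : ∀ x, w * x = x * w) :
    ∃ v : (Matrix ι ι R)ˣ, (v : Matrix ι ι R) = 1 - w • N ^ (n + 1) ∧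
      F.hypCls _ v = F.hypCls _ u := by
  let L : Matrix (ι × Fin (n + 1)) (ι × Fin (n + 1)) R :=
    Matrix.of fun x y => if x.2.val = y.2.val + 1 then N x.1 y.1 else 0
  obtain ⟨t, ht, ht'⟩ := mem_elementaryGroup_of_triangular
    (fun x : ι × Fin (n + 1) => x.2.val) (-L) (by
      intro x y hxy
      by_cases h : x.2.val = y.2.val + 1
      · omega
      · simp [L, h] at hxy)
  -- `U` is the inclusion of block `0`, and `V` is chosen to solve `V (1 - L) = (0, …, 0, wN)`. So
  -- `(1 - UV)(1 - L)` restores the corner entry of `1 - N ⊗ S`, while `VU = w N^(n+1)`.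
  let U : Matrix (ι × Fin (n + 1)) ι R :=
    Matrix.of fun x j => if x.2 = 0 ∧ x.1 = j then 1 else 0
  let V : Matrix ι (ι × Fin (n + 1)) R :=
    Matrix.of fun j y => w * (N ^ (n + 1 - y.2.val)) j y.1
  have hU : ∀ (M : Matrix ι (ι × Fin (n + 1)) R) x y,
      (U * M) x y = if x.2 = 0 then M x.1 y else 0 := by
    intro M x y
    by_cases h : x.2 = 0 <;> simp [mul_apply, U, h]
  have hVU : V * U = w • N ^ (n + 1) := by
    ext i j
    rw [mul_apply, Fintype.sum_prod_type, Finset.sum_eq_single j]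
    · rw [Finset.sum_eq_single 0]
      · simp [U, V]
      · intro p _ hp
        simp [U, hp]
      · simp
    · intro l _ hl
      simp [U, hl]
    · simp
  have hVL : ∀ j y, (V * L) j y = if y.2.val = n then 0 else V j y := by
    intro j y
    rw [mul_apply, Fintype.sum_prod_type]
    split_ifs with h
    · refine Finset.sum_eq_zero fun l _ => Finset.sum_eq_zero fun p _ => ?_
      have : ¬ p.val = y.2.val + 1 := by have := p.2; omega
      simp [L, this]
    · have hy : y.2.val + 1 < n + 1 := by have := y.2.2; omega
      have h1 : n + 1 - y.2.val = n + 1 - (y.2.val + 1) + 1 := by omega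
      change _ = w * (N ^ (n + 1 - y.2.val)) j y.1
      rw [h1, pow_succ, mul_apply, Finset.mul_sum]
      refine Finset.sum_congr rfl fun l _ => ?_
      rw [Finset.sum_eq_single ⟨y.2.val + 1, hy⟩]
      · simp [L, V, mul_assoc]
      · intro p _ hp
        have : ¬ p.val = y.2.val + 1 := fun h => hp (Fin.ext h)
        simp [L, this]
      · simp
  have hfac : (u : Matrix (ι × Fin (n + 1)) (ι × Fin (n + 1)) R) =
      (1 - U * V) * (t : Matrix (ι × Fin (n + 1)) (ι × Fin (n + 1)) R) := by
    rw [hu, ht', ← sub_eq_add_neg, mul_sub, mul_one, sub_mul, one_mul, Matrix.mul_assoc U V L]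
    ext x y
    simp only [Matrix.sub_apply, hU, hVL, of_apply]
    have e : ∀ a b c d : R, a - b - (c - d) = a - (c + (b - d)) := fun a b c d => by abel
    rw [e]
    congr 1
    simp only [shiftMatrix, of_apply, mul_add, mul_ite, mul_one, mul_zero, L]
    congr 1
    have hx0 : x.2.val = 0 ↔ x.2 = 0 := Fin.val_eq_zero_iff
    by_cases hx : x.2 = 0
    · by_cases hy : y.2.val = n
      · simp [hx, hy, V, hw]
      · simp [hx, hy]
    · simp [hx]
  obtain ⟨v, hv, hv'⟩ := F.hypCls_one_sub_mul U V (u * t⁻¹) (by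
    rw [Units.val_mul, hfac, mul_assoc, Units.mul_inv, mul_one])
  refine ⟨v, by rw [hv, hVU], ?_⟩
  rw [hv', map_mul, map_inv, F.hypCls_eq_one_of_mem ht, inv_one, mul_one]

end Shift

end Scalars

/-- Successive approximation: if `f^k = 1 - X + X^(M+1) q`, then multiplying `f` by `1 - b X^(M+1)`
with `k b = q(0)` cancels the leading error term. Only factors `1 - a X^(n+1)` are used because
these are the ones realized by transfers. -/
theorem exists_truncated_root {A : Type*} [CommRing A] (k : ℕ) (y : A) (hy : (k : A) * y = 1)
    (M : ℕ) : ∃ f ∈ Submonoid.closure {g : A[X] | ∃ (a : A) (n : ℕ), g = 1 - C a * X ^ (n + 1)},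
      X ^ (M + 1) ∣ f ^ k - (1 - X) := by
  induction M with
  | zero => exact ⟨1, one_mem _, by simp⟩
  | succ M ih =>
    obtain ⟨f, hf, q, hq⟩ := ih
    obtain ⟨q', hq'⟩ := X_dvd_sub_C (p := q)
    set b : A[X] := C (y * q.coeff 0) with hb
    have hkb : (k : A[X]) * b = C (q.coeff 0) := by
      rw [hb, ← C_eq_natCast, ← C_mul, ← mul_assoc, hy, one_mul]
    refine ⟨f * (1 - b * X ^ (M + 1)),
      mul_mem hf (Submonoid.subset_closure ⟨_, M, rfl⟩), ?_⟩
    obtain ⟨r, hr⟩ := Polynomial.powAddExpansion 1 (-(b * X ^ (M + 1))) k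
    rw [mul_pow, sub_eq_add_neg 1, hr, one_pow, one_pow, mul_one, mul_neg, ← mul_assoc (k : A[X]),
      hkb]
    have h1 : f ^ k = 1 - X + X ^ (M + 1) * q := by rw [← hq]; ring
    have h2 : q = C (q.coeff 0) + X * q' := by rw [← hq']; ring
    generalize (C (q.coeff 0) : A[X]) = c at *
    refine ⟨q' + c - c * q * X ^ M + (1 - X + X ^ (M + 1) * q) * r * b ^ 2 * X ^ M, ?_⟩
    rw [h1]
    have h3 : q - c = X * q' := hq'
    linear_combination X ^ (M + 1) * h3

/-! ### Absence of `k`-torsion -/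

section Main

variable {R : Type*} [Ring R] [StarRing R] (F : FormRing R)
variable {ι : Type*} [Fintype ι] [DecidableEq ι]

/-- The transfer substituting for `X` the companion matrix of `T^(n+1) - a X^(n+1)` is
multiplicative and preserves trivial classes, so it is applied to `u^k`. -/
theorem exists_hypCls_pow_eq_one (k : ℕ) (N : Matrix ι ι R) (u : (Matrix ι ι R[X])ˣ)
    (hu : (u : Matrix ι ι R[X]) = 1 - (X : R[X]) • N.map C) (huk : F.poly.hypCls ι u ^ k = 1)
    {a : R} (ha : a ∈ F.scalars) (n : ℕ) :
    ∃ v : (Matrix ι ι R[X])ˣ,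
      (v : Matrix ι ι R[X]) = 1 - (C a * X ^ (n + 1)) • (N.map (C : R →+* R[X])) ^ (n + 1) ∧
      F.poly.hypCls ι v ^ k = 1 := by
  have hw : C a * X ^ (n + 1) ∈ F.poly.scalars :=
    mul_mem (F.C_mem_scalars ha) (pow_mem F.X_mem_scalars _)
  let T := F.polyTransfer (shiftMatrix n (C a * X ^ (n + 1))) (antidiag R[X] n)
    (F.poly.shiftMatrix_mem_scalars n _ hw) (F.poly.antidiag_mem_scalars n)
    (conjTranspose_antidiag n) (antidiag_mul_antidiag n) (antidiag_mul_shiftMatrix n _ hw.2.1)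
  obtain ⟨v, hv, hvu⟩ := F.poly.hypCls_one_sub_shift n (C a * X ^ (n + 1)) (N.map C)
    (Units.map (T.expandHom ι) u) (by
      change T.expand (u : Matrix ι ι R[X]) = _
      rw [hu]
      exact F.polyTransfer_expand _ _ _ _ _ N) hw.1
  refine ⟨v, hv, ?_⟩
  rw [hvu, ← map_pow, ← map_pow]
  exact T.hypCls_expand_eq_one (by rw [map_pow, huk])

/-- Stability of `Λ` under `y` comes from `y c = k · (star y * c * y)`: the form parameter is closed
under conjugation and under integer multiples. -/
theorem scalars_inv_mem {k : ℕ} {y : R} (hy : (k : R) * y = 1) : y ∈ F.scalars := by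
  have hky : y * (k : R) = 1 := by rw [← hy, Nat.cast_comm]
  have hc : ∀ x, y * x = x * y := fun x => by
    calc y * x = y * x * ((k : R) * y) := by rw [hy, mul_one]
      _ = y * (k : R) * x * y := by
        rw [← mul_assoc, mul_assoc y x, ← Nat.cast_comm, ← mul_assoc]
      _ = x * y := by rw [hky, one_mul]
  have hs : star y = y := by
    have h := congrArg star hky
    rw [star_mul, star_natCast, star_one] at h
    calc star y = star y * ((k : R) * y) := by rw [hy, mul_one]
      _ = (k : R) * star y * y := by rw [← mul_assoc, Nat.cast_comm]
      _ = y := by rw [h, one_mul]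
  refine ⟨hc, hs, fun c hcm => ?_⟩
  have h1 : y * c = k • (star y * c * y) := by
    rw [hs, nsmul_eq_mul, mul_assoc, ← hc c, ← mul_assoc, ← mul_assoc, hy, one_mul]
  rw [h1]
  exact F.param.nsmul_mem (F.conj_mem _ _ hcm) _

theorem hypCls_eq_one_of_pow_eq_one {k : ℕ} {y : R} (hy : (k : R) * y = 1) {N : Matrix ι ι R}
    (hN : IsNilpotent N) (u : (Matrix ι ι R[X])ˣ)
    (hu : (u : Matrix ι ι R[X]) = 1 - (X : R[X]) • N.map C) (huk : F.poly.hypCls ι u ^ k = 1) :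
    F.poly.hypCls ι u = 1 := by
  set N' : Matrix ι ι R[X] := N.map (C : R →+* R[X]) with hN'
  have hcomm : ∀ (z : R[X]), z ∈ F.poly.scalars → ∀ M : Matrix ι ι R[X],
      Commute (scalar ι z) M := fun z hz M => by
    ext1 i j
    simp [hz.1 (M i j)]
  -- Substitution of `XN` for the variable. Its source is commutative, so the matrices of all
  -- factors commute.
  let φ : F.scalars[X] →+* Matrix ι ι R[X] :=
    eval₂RingHom' ((scalar ι).comp (C.comp F.scalars.subtype)) ((X : R[X]) • N')
      fun a => hcomm _ (F.C_mem_scalars a.2) _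
  have hφX : φ X = (X : R[X]) • N' := eval₂_X _ _
  have hφC : ∀ a, φ (C a) = scalar ι (C (a : R)) := fun a => eval₂_C _ _
  have hsm : ∀ (z : R[X]) (M : Matrix ι ι R[X]), z • M = scalar ι z * M := fun z M => by
    ext1 i j
    simp
  have hpow : ∀ n, φ X ^ n = (X ^ n : R[X]) • N' ^ n := fun n => by
    rw [hφX, hsm, (hcomm X F.X_mem_scalars N').mul_pow, hsm, map_pow]
  have key : ∀ f ∈ Submonoid.closure
      {g : F.scalars[X] | ∃ (a : F.scalars) (n : ℕ), g = 1 - C a * X ^ (n + 1)},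
      ∃ v : (Matrix ι ι R[X])ˣ, (v : Matrix ι ι R[X]) = φ f ∧ F.poly.hypCls ι v ^ k = 1 := by
    intro f hf
    induction hf using Submonoid.closure_induction with
    | mem g hg =>
      obtain ⟨a, n, rfl⟩ := hg
      obtain ⟨v, hv, hvk⟩ := F.exists_hypCls_pow_eq_one k N u hu huk a.2 n
      refine ⟨v, ?_, hvk⟩
      rw [hv, map_sub, map_one, map_mul, map_pow, hφC, hpow, ← hsm, smul_smul]
    | one => exact ⟨1, by simp, by simp⟩
    | mul f g _ _ hf hg =>
      obtain ⟨v, hv, hvk⟩ := hf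
      obtain ⟨v', hv', hvk'⟩ := hg
      refine ⟨v * v', by rw [Units.val_mul, hv, hv', map_mul], ?_⟩
      have hvv : Commute v v' := Units.ext (by
        rw [Units.val_mul, Units.val_mul, hv, hv', ← map_mul, mul_comm, map_mul])
      rw [map_mul, (hvv.map (F.poly.hypCls ι)).mul_pow, hvk, hvk', one_mul]
  obtain ⟨d, hd⟩ := hN
  -- The error is a multiple of `X^(d+1)`, which vanishes at `XN` because `N^d = 0`; the truncated
  -- root becomes an exact one.
  obtain ⟨f, hf, q, hq⟩ := exists_truncated_root k (⟨y, F.scalars_inv_mem hy⟩ : F.scalars)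
    (Subtype.ext (by simpa using hy)) d
  obtain ⟨v, hv, hvk⟩ := key f hf
  have hd' : N' ^ (d + 1) = 0 := by
    rw [pow_succ, hN', ← RingHom.mapMatrix_apply, ← map_pow, hd, map_zero, zero_mul]
  have h1 : u = v ^ k := by
    refine Units.ext ?_
    rw [Units.val_pow_eq_pow_val, hv, ← map_pow, sub_eq_iff_eq_add.1 hq, map_add, map_mul, map_pow,
      hpow, hd', smul_zero, zero_mul, zero_add, map_sub, map_one, hφX, hu]
  rw [h1, map_pow, hvk]

end Main

end FormRing

theorem theorem1p1 {R : Type*} [Ring R] [StarRing R] (F : FormRing R)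
    (k : ℕ) (hk : ∀ x : R, ∃ y : R, (k : R) * y = x)
    (r : ℕ) (α : F.poly.GQ (Fin r))
    (hNK : F.poly.cls α ∈ F.NK1GQ)
    (hA : IsUnit (α.1 : Matrix (Fin r ⊕ Fin r) (Fin r ⊕ Fin r) (Polynomial R)).toBlocks₁₁) :
    F.poly.cls α ^ k = 1 → F.poly.cls α = 1 := by
  intro hαk
  obtain ⟨u, hu⟩ := hA
  obtain ⟨y, hy⟩ := hk 1
  have h1 : F.poly.cls α = F.poly.hypCls (Fin r) u := by
    rw [← F.poly.clsHom_fin, F.poly.clsHom_eq_hypCls α u hu]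
  rw [h1] at hNK hαk ⊢
  obtain ⟨κ, _, _, N, v, hN, hv, hvu⟩ := F.exists_nilpotent_of_mem_NK1GQ u hNK
  rw [← hvu] at hαk ⊢
  exact F.hypCls_eq_one_of_pow_eq_one hy hN v hv hαk
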